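/- Let $n\ge 0$ be an integer, let $B_1\subset\mathbb R^n$ be the open unit ball centred at the origin, and put $c=\cos\frac{\pi}{4}$, $s=\sin\frac{\pi}{4}$. Let $\psi=\psi(x,r,p)$ be a continuous real-valued function on $B_1\times\mathbb R\times\mathbb R^n$, and let $u:B_1\to\mathbb R$ be a convex viscosity solution on $B_1$ of $$\sum_{i=1}^n\arctan\lambda_i(D^2u)=\psi(x,u,Du),$$ where $\lambda_i$ are the eigenvalues of the Hessian. (A function $v$ is a viscosity solution of $\sum_i\arctan\lambda_i(D^2v)=f(x,v,Dv)$ on $\Omega$ if it is continuous on $\Omega$ and, whenever $\varphi$ is $C^2$ near $x_0\in\Omega$ and $v-\varphi$ has a local maximum [resp. minimum] over $\Omega$ at $x_0$, one has $\sum_i\arctan\lambda_i(D^2\varphi(x_0))\ge f(x_0,v(x_0),D\varphi(x_0))$ [resp. $\le$].) Define $$\tilde u(x)=s\,u(x)+\tfrac c2|x|^2\quad(x\in B_1),\qquad \tilde u^*(\bar x)=\sup_{x\in B_1}\bigl[x\cdot\bar x-\tilde u(x)\bigr],\qquad \bar u(\bar x)=\frac{c}{2s}|\bar x|^2-\frac1s\,\tilde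 u^*(\bar x),$$ and let $\bar\Omega=\partial\tilde u(B_1)=\bigcup_{x\in B_1}\partial\tilde u(x)$, where $\partial\tilde u(x)=\{y:\ \tilde u(z)\ge\tilde u(x)+y\cdot(z-x)\ \text{for all } z\in B_1\}$ is the subdifferential. Suppose that either $u\in C^1(B_1)$, or $p\mapsto\psi(x,r,p)$ is convex on $\mathbb R^n$ for each fixed $(x,r)\in B_1\times\mathbb R$. Then $\bar\Omega$ is open, $\bar u$ is differentiable on $\bar\Omega$ with $x(\bar x):=c\bar x-sD\bar u(\bar x)\in B_1$ for every $\bar x\in\bar\Omega$, and $\bar u$ is a viscosity solution on $\bar\Omega$ of the rotated equation $$\sum_{i=1}^n\arctan\lambda_i(D^2\bar u(\bar x))=\psi\bigl(x(\bar x),\,u(x(\bar x)),\,s\bar x+cD\bar u(\bar x)\bigr)-\frac{n\pi}{4}.$$ -/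

import Mathlib

open Set Metric

open scoped RealInnerProductSpace

noncomputable section

/-- The Hessian matrix `D²φ(x)`, with entries `∂ᵢ∂ⱼφ(x)` in the standard basis. -/
def hessian {n : ℕ} (φ : EuclideanSpace ℝ (Fin n) → ℝ) (x : EuclideanSpace ℝ (Fin n)) :
    Matrix (Fin n) (Fin n) ℝ :=
  Matrix.of fun i j =>
    fderiv ℝ (fderiv ℝ φ) x (EuclideanSpace.single i 1) (EuclideanSpace.single j 1)

/-- The Lagrangian phase `θ(A) = ∑ arctan λᵢ` of a real symmetric matrix `A`, where the `λᵢ` are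
the eigenvalues of `A` repeated with multiplicity, i.e. the roots of its characteristic
polynomial. -/
def phase {n : ℕ} (A : Matrix (Fin n) (Fin n) ℝ) : ℝ :=
  (A.charpoly.roots.map Real.arctan).sum

/-- `phase` is the sum of the arctangents of the eigenvalues. -/
theorem phase_eq_sum_eigenvalues {n : ℕ} {A : Matrix (Fin n) (Fin n) ℝ} (hA : A.IsHermitian) :
    phase A = ∑ i, Real.arctan (hA.eigenvalues i) := by
  have h := hA.roots_charpoly_eq_eigenvalues
  simp only [phase, h, Multiset.map_map]
  rfl

/-- `u` is a viscosity solution of `∑ arctan λᵢ(D²u) = f(x, u, Du)` on `Ω`: it is continuous, and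
the equation holds as the inequality `≥` (resp. `≤`) for every `C²` test function touching `u`
from above (resp. below) at a point of `Ω`, the gradient being that of the test function. -/
structure IsViscositySolution {n : ℕ} (Ω : Set (EuclideanSpace ℝ (Fin n)))
    (f : EuclideanSpace ℝ (Fin n) → ℝ → EuclideanSpace ℝ (Fin n) → ℝ)
    (u : EuclideanSpace ℝ (Fin n) → ℝ) : Prop where
  continuousOn : ContinuousOn u Ω
  subsolution : ∀ x ∈ Ω, ∀ φ : EuclideanSpace ℝ (Fin n) → ℝ, ContDiffAt ℝ 2 φ x →
    IsLocalMaxOn (fun y => u y - φ y) Ω x → f x (u x) (gradient φ x) ≤ phase (hessian φ x)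
  supersolution : ∀ x ∈ Ω, ∀ φ : EuclideanSpace ℝ (Fin n) → ℝ, ContDiffAt ℝ 2 φ x →
    IsLocalMinOn (fun y => u y - φ y) Ω x → phase (hessian φ x) ≤ f x (u x) (gradient φ x)

/-- The subdifferential at `x` of a function `f` with domain `Ω`: the slopes of the affine
functions that touch `f` from below at `x`. -/
def subdifferential {n : ℕ} (Ω : Set (EuclideanSpace ℝ (Fin n)))
    (f : EuclideanSpace ℝ (Fin n) → ℝ) (x : EuclideanSpace ℝ (Fin n)) :
    Set (EuclideanSpace ℝ (Fin n)) :=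
  {y | ∀ z ∈ Ω, f x + ⟪y, z - x⟫ ≤ f z}

/-- The Legendre transform `f*(y) = sup_{x ∈ Ω} (x · y - f x)` of a function with domain `Ω`. -/
def legendre {n : ℕ} (Ω : Set (EuclideanSpace ℝ (Fin n)))
    (f : EuclideanSpace ℝ (Fin n) → ℝ) (y : EuclideanSpace ℝ (Fin n)) : ℝ :=
  sSup ((fun x => ⟪x, y⟫ - f x) '' Ω)

/-- The supremum in `legendre` is attained, hence finite, at every subgradient of `f`. -/
theorem isGreatest_legendre {n : ℕ} {Ω : Set (EuclideanSpace ℝ (Fin n))}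
    {f : EuclideanSpace ℝ (Fin n) → ℝ} {x y : EuclideanSpace ℝ (Fin n)} (hx : x ∈ Ω)
    (hy : y ∈ subdifferential Ω f x) :
    IsGreatest ((fun x => ⟪x, y⟫ - f x) '' Ω) (legendre Ω f y) := by
  have h : IsGreatest ((fun x => ⟪x, y⟫ - f x) '' Ω) (⟪x, y⟫ - f x) := by
    refine ⟨⟨x, hx, rfl⟩, ?_⟩
    rintro _ ⟨z, hz, rfl⟩
    have h1 := hy z hz
    rw [inner_sub_right, real_inner_comm z y, real_inner_comm x y] at h1
    show ⟪z, y⟫ - f z ≤ ⟪x, y⟫ - f x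
    linarith
  have e : legendre Ω f y = ⟪x, y⟫ - f x := h.csSup_eq
  rw [e]
  exact h

/-- The auxiliary function `ũ(x) = s u(x) + (c/2)|x|²`, with `c = cos (π/4)`, `s = sin (π/4)`. -/
def auxPotential {n : ℕ} (u : EuclideanSpace ℝ (Fin n) → ℝ) (x : EuclideanSpace ℝ (Fin n)) : ℝ :=
  Real.sin (Real.pi / 4) * u x + Real.cos (Real.pi / 4) / 2 * ‖x‖ ^ 2

/-- The rotated domain `∂ũ(Ω) = ⋃_{x ∈ Ω} ∂ũ(x)`. -/
def rotatedDomain {n : ℕ} (Ω : Set (EuclideanSpace ℝ (Fin n)))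
    (u : EuclideanSpace ℝ (Fin n) → ℝ) : Set (EuclideanSpace ℝ (Fin n)) :=
  ⋃ x ∈ Ω, subdifferential Ω (auxPotential u) x

/-- The rotated potential `ū(x̄) = (c/(2s))|x̄|² - (1/s) ũ*(x̄)` of a function `u` with
domain `Ω`. -/
def rotatedPotential {n : ℕ} (Ω : Set (EuclideanSpace ℝ (Fin n)))
    (u : EuclideanSpace ℝ (Fin n) → ℝ) (y : EuclideanSpace ℝ (Fin n)) : ℝ :=
  Real.cos (Real.pi / 4) / (2 * Real.sin (Real.pi / 4)) * ‖y‖ ^ 2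
    - 1 / Real.sin (Real.pi / 4) * legendre Ω (auxPotential u) y

/-- The point `c x̄ - s p`. For `p = Dū(x̄)` it is the base point `x(x̄)` of the original graph
that is rotated to the point of the new graph over `x̄`. -/
def basePoint {n : ℕ} (y p : EuclideanSpace ℝ (Fin n)) : EuclideanSpace ℝ (Fin n) :=
  Real.cos (Real.pi / 4) • y - Real.sin (Real.pi / 4) • p

/-- The right-hand side of the rotated equation,
`(x̄, p) ↦ ψ(x, u(x), s x̄ + c p) - nπ/4` with `x = c x̄ - s p`; it does not depend on the value
of the unknown. -/
def rotatedPhase {n : ℕ}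
    (ψ : EuclideanSpace ℝ (Fin n) → ℝ → EuclideanSpace ℝ (Fin n) → ℝ)
    (u : EuclideanSpace ℝ (Fin n) → ℝ)
    (y : EuclideanSpace ℝ (Fin n)) (_r : ℝ) (p : EuclideanSpace ℝ (Fin n)) : ℝ :=
  ψ (basePoint y p) (u (basePoint y p))
      (Real.sin (Real.pi / 4) • y + Real.cos (Real.pi / 4) • p)
    - n * Real.pi / 4

end

/-! Write F for `auxPotential u`, F* for its Legendre transform, and c = s = cos(π/4). Since F is
strongly convex, its subdifferential is the inverse of a single-valued Lipschitz map, the gradient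
of F*. Hence the rotated domain is open, ū is differentiable there, and x(x̄) is the point at which
x̄ is a subgradient of F. Formally, an eigenvalue d of D²F corresponds to (d - c)/s for u, to 1/d
for F* and to (c - 1/d)/s for ū, and `arctan_rotate` says that the last angle is the second minus
π/4. The work lies in giving this computation a viscosity meaning; F* enters ū with a minus sign, so
upper and lower bounds are exchanged.

Supersolution. A test function below ū bounds F* from above by a quadratic, whose form must be
positive because F* is convex. Fenchel's inequality turns this into a lower quadratic bound for F
with the inverse form, which is a test function for u (`eventually_le_of_legendre_le`). Nothing is
needed about ψ.

Subsolution. A test function above ū bounds F* from below by a quadratic whose form may be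
degenerate or indefinite, and then it has no dual bound for F. So u is first regularized. By
Alexandrov's theorem the subsolution inequality holds pointwise almost everywhere. Under either
alternative of the hypothesis the right-hand side is locally bounded below, up to ε, by an affine
function of the gradient (`exists_affine_le_rhs`). The phase is concave on nonnegative forms and the
singular part of the Hessian of a convex function is nonnegative, so mollification preserves the
affine inequality (`le_formPhase_mollify`). Strict touching survives uniform approximation
(`StrongConvexOn.exists_touching_near`), and for the smooth approximation the touching form lies
below the inverse Hessian, so that monotonicity of the phase concludes
(`formPhase_sub_le_of_touching`). -/

noncomputable section

variable {n : ℕ}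

local notation "𝔼" => EuclideanSpace ℝ (Fin n)

open Filter Topology MeasureTheory

/-! ### Phases of symmetric forms: monotonicity, concavity, rotation -/

/-- The phase of a bilinear form on Euclidean space. -/
def formPhase (b : 𝔼 →L[ℝ] 𝔼 →L[ℝ] ℝ) : ℝ :=
  phase (Matrix.of fun i j => b (EuclideanSpace.single i 1) (EuclideanSpace.single j 1))

/-- The symmetric bilinear form with eigenbasis `e` and eigenvalues `d`. -/
def diagForm (e : OrthonormalBasis (Fin n) ℝ 𝔼) (d : Fin n → ℝ) : 𝔼 →L[ℝ] 𝔼 →L[ℝ] ℝ :=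
  ∑ i, d i • (innerSL ℝ (e i)).smulRight (innerSL ℝ (e i))

theorem diagForm_apply (e : OrthonormalBasis (Fin n) ℝ 𝔼) (d : Fin n → ℝ) (h k : 𝔼) :
    diagForm e d h k = ∑ i, d i * (⟪e i, h⟫ * ⟪e i, k⟫) := by
  simp [diagForm]

theorem diagForm_basis (e : OrthonormalBasis (Fin n) ℝ 𝔼) (d : Fin n → ℝ) (i : Fin n) :
    diagForm e d (e i) (e i) = d i := by
  rw [diagForm_apply, Finset.sum_eq_single i]
  · simp
  · intro j _ hj
    simp [e.inner_eq_zero hj]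
  · simp

theorem diagForm_comm (e : OrthonormalBasis (Fin n) ℝ 𝔼) (d : Fin n → ℝ) (h k : 𝔼) :
    diagForm e d h k = diagForm e d k h := by
  simp only [diagForm_apply, mul_comm ⟪e _, h⟫]

theorem diagForm_const (e : OrthonormalBasis (Fin n) ℝ 𝔼) (t : ℝ) (h k : 𝔼) :
    diagForm e (fun _ => t) h k = t * ⟪h, k⟫ := by
  rw [diagForm_apply, ← Finset.mul_sum, ← e.sum_inner_mul_inner h k]
  simp only [real_inner_comm h]

theorem ext_single {b b' : 𝔼 →L[ℝ] 𝔼 →L[ℝ] ℝ}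
    (h : ∀ i j, b (EuclideanSpace.single i 1) (EuclideanSpace.single j 1) =
      b' (EuclideanSpace.single i 1) (EuclideanSpace.single j 1)) : b = b' := by
  have key : b.toLinearMap₁₂ = b'.toLinearMap₁₂ := by
    apply LinearMap.ext_basis (EuclideanSpace.basisFun (Fin n) ℝ).toBasis
      (EuclideanSpace.basisFun (Fin n) ℝ).toBasis
    intro i j
    simpa using h i j
  ext x y
  exact congrArg (fun f => f x y) key

/-- The coordinate matrix is P D Pᵀ with P orthogonal, and charpoly(AB) = charpoly(BA) brings Pᵀ
next to P. -/
theorem formPhase_diagForm (e : OrthonormalBasis (Fin n) ℝ 𝔼) (d : Fin n → ℝ) :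
    formPhase (diagForm e d) = ∑ i, Real.arctan (d i) := by
  set P : Matrix (Fin n) (Fin n) ℝ := Matrix.of fun i k => e k i with hP
  have hPP : P.transpose * P = 1 := by
    ext i j
    have := (orthonormal_iff_ite.mp e.orthonormal) i j
    simp only [PiLp.inner_apply, RCLike.inner_apply, conj_trivial] at this
    simp only [Matrix.mul_apply, Matrix.transpose_apply, hP, Matrix.of_apply, Matrix.one_apply]
    rw [← this]
    exact Finset.sum_congr rfl fun k _ => mul_comm _ _
  have hM : (Matrix.of fun i j => diagForm e d (EuclideanSpace.single i 1)
      (EuclideanSpace.single j 1)) = P * (Matrix.diagonal d * P.transpose) := by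
    ext i j
    simp only [Matrix.of_apply, diagForm_apply, Matrix.mul_apply,
      Matrix.transpose_apply, hP]
    refine Finset.sum_congr rfl fun k _ => ?_
    simp [EuclideanSpace.inner_single_right, Matrix.diagonal_apply]
    ring
  rw [formPhase, hM, phase, Matrix.charpoly_mul_comm, Matrix.mul_assoc, hPP, Matrix.mul_one,
    Matrix.charpoly_diagonal]
  have := Polynomial.roots_multiset_prod_X_sub_C (Finset.univ.val.map d)
  rw [Multiset.map_map] at this
  change (Multiset.map Real.arctan
    (Multiset.map (fun i => Polynomial.X - Polynomial.C (d i)) Finset.univ.val).prod.roots).sum = _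
  rw [show (fun i => Polynomial.X - Polynomial.C (d i)) =
    (fun a => Polynomial.X - Polynomial.C a) ∘ d from rfl, this, Multiset.map_map]
  rfl

theorem exists_eq_diagForm {b : 𝔼 →L[ℝ] 𝔼 →L[ℝ] ℝ} (hb : ∀ h k, b h k = b k h) :
    ∃ (e : OrthonormalBasis (Fin n) ℝ 𝔼) (d : Fin n → ℝ), b = diagForm e d := by
  set A : Matrix (Fin n) (Fin n) ℝ :=
    Matrix.of fun i j => b (EuclideanSpace.single i 1) (EuclideanSpace.single j 1) with hA
  have hH : A.IsHermitian := by
    ext i j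
    simp [hA, hb (EuclideanSpace.single j 1)]
  refine ⟨hH.eigenvectorBasis, hH.eigenvalues, ext_single fun i j => ?_⟩
  have := congrFun (congrFun hH.spectral_theorem i) j
  change A i j = _
  rw [this]
  simp [Unitary.conjStarAlgAut_apply, Matrix.mul_apply, diagForm_apply, Matrix.diagonal_apply,
    EuclideanSpace.inner_single_right]
  exact Finset.sum_congr rfl fun k _ => by ring

theorem OrthonormalBasis.inner_eq_zero_of_mem_span (e : OrthonormalBasis (Fin n) ℝ 𝔼)
    {I : Finset (Fin n)} {x : 𝔼} (hx : x ∈ Submodule.span ℝ (e '' (I : Set (Fin n))))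
    {i : Fin n} (hi : i ∉ I) : ⟪e i, x⟫ = 0 := by
  induction hx using Submodule.span_induction with
  | mem y hy =>
    obtain ⟨j, hj, rfl⟩ := hy
    exact e.inner_eq_zero (by rintro rfl; exact hi hj)
  | zero => simp
  | add y z _ _ hy hz => rw [inner_add_right, hy, hz, add_zero]
  | smul a y _ hy => rw [inner_smul_right, hy, mul_zero]

theorem OrthonormalBasis.finrank_span_image (e : OrthonormalBasis (Fin n) ℝ 𝔼)
    (I : Finset (Fin n)) :
    Module.finrank ℝ (Submodule.span ℝ (e '' (I : Set (Fin n)))) = I.card := by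
  have h := finrank_span_eq_card
    (e.orthonormal.linearIndependent.comp (fun i : I => (i : Fin n)) Subtype.val_injective)
  rw [Fintype.card_coe] at h
  rw [← h, Set.image_eq_range]
  rfl

/-- Eigenvalue counting: at least as many eigenvalues of the larger form lie above a level. -/
theorem card_filter_le_of_diagForm_le {e e' : OrthonormalBasis (Fin n) ℝ 𝔼} {d d' : Fin n → ℝ}
    (h : ∀ x, diagForm e d x x ≤ diagForm e' d' x x) (t : ℝ) :
    (Finset.univ.filter fun i => t ≤ d i).card ≤ (Finset.univ.filter fun i => t ≤ d' i).card := by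
  set I := Finset.univ.filter fun i => t ≤ d i
  set J := Finset.univ.filter fun i => t ≤ d' i
  -- On the first span the smaller form is at least t‖x‖²; on the second the larger form is strictly
  -- below t‖x‖² unless x = 0. Trivial intersection bounds the sum of the dimensions by n.
  have hdisj : Disjoint (Submodule.span ℝ (e '' (I : Set (Fin n))))
      (Submodule.span ℝ (e' '' ((Jᶜ : Finset (Fin n)) : Set (Fin n)))) := by
    rw [Submodule.disjoint_def]
    intro x hx hx'
    have h1 : ∀ i, ¬ t ≤ d i → ⟪e i, x⟫ = 0 := fun i hi =>
      e.inner_eq_zero_of_mem_span hx (by simpa [I] using hi)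
    have h2 : ∀ i, t ≤ d' i → ⟪e' i, x⟫ = 0 := fun i hi =>
      e'.inner_eq_zero_of_mem_span hx' (by simpa [J] using hi)
    have h3 : t * ⟪x, x⟫ ≤ diagForm e d x x := by
      rw [← diagForm_const e, diagForm_apply, diagForm_apply]
      refine Finset.sum_le_sum fun i _ => ?_
      by_cases hi : t ≤ d i
      · gcongr
        exact mul_self_nonneg _
      · simp [h1 i hi]
    have h4 := h3.trans (h x)
    rw [← diagForm_const e', diagForm_apply, diagForm_apply] at h4
    have h5 : ∀ i ∈ Finset.univ, d' i * (⟪e' i, x⟫ * ⟪e' i, x⟫) ≤ t * (⟪e' i, x⟫ * ⟪e' i, x⟫) := by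
      intro i _
      by_cases hi : t ≤ d' i
      · simp [h2 i hi]
      · exact mul_le_mul_of_nonneg_right (not_le.mp hi).le (mul_self_nonneg _)
    have h6 := (Finset.sum_eq_sum_iff_of_le h5).mp (le_antisymm (Finset.sum_le_sum h5) h4)
    rw [← e'.sum_repr' x]
    refine Finset.sum_eq_zero fun i hi => ?_
    by_cases hi' : t ≤ d' i
    · rw [h2 i hi', zero_smul]
    · have h7 := h6 i hi
      have : (t - d' i) * (⟪e' i, x⟫ * ⟪e' i, x⟫) = 0 := by linarith
      rcases mul_eq_zero.mp this with h8 | h8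
      · exact absurd (by linarith) hi'
      · rw [mul_self_eq_zero.mp h8, zero_smul]
  have hdim := Submodule.finrank_add_finrank_le_of_disjoint hdisj
  rw [e.finrank_span_image, e'.finrank_span_image, finrank_euclideanSpace_fin] at hdim
  have := J.card_add_card_compl
  rw [Fintype.card_fin] at this
  omega

/-- Eigenvalue counting is exactly Hall's condition for matching each eigenvalue of `b` injectively
with an eigenvalue of `b'` that is at least as large, so no ordering of the spectra is needed. -/
theorem formPhase_mono {b b' : 𝔼 →L[ℝ] 𝔼 →L[ℝ] ℝ} (hb : ∀ h k, b h k = b k h)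
    (hb' : ∀ h k, b' h k = b' k h) (hle : ∀ x, b x x ≤ b' x x) : formPhase b ≤ formPhase b' := by
  obtain ⟨e, d, rfl⟩ := exists_eq_diagForm hb
  obtain ⟨e', d', rfl⟩ := exists_eq_diagForm hb'
  have hall : ∀ I : Finset (Fin n),
      I.card ≤ (I.biUnion fun i => Finset.univ.filter fun j => d i ≤ d' j).card := by
    intro I
    rcases I.eq_empty_or_nonempty with rfl | hI
    · simp
    obtain ⟨i₀, hi₀, hmin⟩ := I.exists_min_image d hI
    calc I.card ≤ (Finset.univ.filter fun i => d i₀ ≤ d i).card :=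
          Finset.card_le_card fun i hi => by simpa using hmin i hi
      _ ≤ (Finset.univ.filter fun i => d i₀ ≤ d' i).card := card_filter_le_of_diagForm_le hle _
      _ ≤ _ := Finset.card_le_card (Finset.subset_biUnion_of_mem
          (fun i => Finset.univ.filter fun j => d i ≤ d' j) hi₀)
  obtain ⟨σ, hσ, hmem⟩ := (Finset.all_card_le_biUnion_card_iff_exists_injective _).mp hall
  rw [formPhase_diagForm, formPhase_diagForm,
    ← Equiv.sum_comp (Equiv.ofBijective σ (Finite.injective_iff_bijective.mp hσ))
      (fun j => Real.arctan (d' j))]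
  refine Finset.sum_le_sum fun i _ => Real.arctan_strictMono.monotone ?_
  simpa using hmem i

/-- The tangent line inequality for the concave function `arctan` on `[0, ∞)`. -/
theorem arctan_le_tangent {a μ : ℝ} (ha : 0 ≤ a) (hμ : 0 ≤ μ) :
    Real.arctan a ≤ Real.arctan μ + (1 + μ ^ 2)⁻¹ * (a - μ) := by
  have hcont : ContinuousOn Real.arctan (Ici 0) := Real.continuous_arctan.continuousOn
  have hconc : ConcaveOn ℝ (Ici (0 : ℝ)) Real.arctan := by
    refine AntitoneOn.concaveOn_of_deriv (convex_Ici 0) hcont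
      Real.differentiable_arctan.differentiableOn ?_
    intro x hx y hy hxy
    rw [interior_Ici, mem_Ioi] at hx hy
    simp only [Real.deriv_arctan]
    gcongr
  have hd := Real.hasDerivAt_arctan' μ
  rcases lt_trichotomy a μ with h | rfl | h
  · have := hconc.le_slope_of_hasDerivAt ha hμ h hd
    rw [slope_def_field, le_div_iff₀ (by linarith)] at this
    linarith
  · simp
  · have := hconc.slope_le_of_hasDerivAt hμ ha h hd
    rw [slope_def_field, div_le_iff₀ (by linarith)] at this
    linarith

/-- On nonnegative forms the phase is concave; this is the bound by the linearization at the form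
with eigenbasis `v` and eigenvalues `μ`. -/
theorem formPhase_le_linearization {b : 𝔼 →L[ℝ] 𝔼 →L[ℝ] ℝ} (hb : ∀ h k, b h k = b k h)
    (hpos : ∀ x, 0 ≤ b x x) (v : OrthonormalBasis (Fin n) ℝ 𝔼) {μ : Fin n → ℝ}
    (hμ : ∀ j, 0 ≤ μ j) :
    formPhase b ≤ ∑ j, (Real.arctan (μ j) + (1 + μ j ^ 2)⁻¹ * (b (v j) (v j) - μ j)) := by
  obtain ⟨e, d, rfl⟩ := exists_eq_diagForm hb
  have hd : ∀ i, 0 ≤ d i := fun i => diagForm_basis e d i ▸ hpos (e i)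
  -- The squared inner products of two orthonormal bases form a doubly stochastic matrix; averaging
  -- the scalar tangent inequality against it gives the bound.
  have h1 : ∀ i, ∑ j, ⟪e i, v j⟫ * ⟪e i, v j⟫ = 1 := by
    intro i
    have := v.sum_inner_mul_inner (e i) (e i)
    simpa [real_inner_comm (e i)] using this
  have h2 : ∀ j, ∑ i, ⟪e i, v j⟫ * ⟪e i, v j⟫ = 1 := by
    intro j
    have := e.sum_inner_mul_inner (v j) (v j)
    simpa [real_inner_comm (v j)] using this
  rw [formPhase_diagForm]
  calc ∑ i, Real.arctan (d i)
      = ∑ i, ∑ j, ⟪e i, v j⟫ * ⟪e i, v j⟫ * Real.arctan (d i) := by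
        simp only [← Finset.sum_mul, h1, one_mul]
    _ ≤ ∑ i, ∑ j, ⟪e i, v j⟫ * ⟪e i, v j⟫ *
          (Real.arctan (μ j) + (1 + μ j ^ 2)⁻¹ * (d i - μ j)) := by
        refine Finset.sum_le_sum fun i _ => Finset.sum_le_sum fun j _ => ?_
        exact mul_le_mul_of_nonneg_left (arctan_le_tangent (hd i) (hμ j)) (mul_self_nonneg _)
    _ = ∑ j, ∑ i, ⟪e i, v j⟫ * ⟪e i, v j⟫ *
          (Real.arctan (μ j) + (1 + μ j ^ 2)⁻¹ * (d i - μ j)) := Finset.sum_comm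
    _ = _ := by
        refine Finset.sum_congr rfl fun j _ => ?_
        rw [diagForm_apply]
        calc ∑ i, ⟪e i, v j⟫ * ⟪e i, v j⟫ * (Real.arctan (μ j) + (1 + μ j ^ 2)⁻¹ * (d i - μ j))
            = (∑ i, ⟪e i, v j⟫ * ⟪e i, v j⟫) * (Real.arctan (μ j) - (1 + μ j ^ 2)⁻¹ * μ j)
              + (1 + μ j ^ 2)⁻¹ * ∑ i, d i * (⟪e i, v j⟫ * ⟪e i, v j⟫) := by
              rw [Finset.sum_mul, Finset.mul_sum, ← Finset.sum_add_distrib]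
              exact Finset.sum_congr rfl fun i _ => by ring
          _ = _ := by rw [h2]; ring

theorem arctan_add_le {a t : ℝ} (ht : 0 ≤ t) : Real.arctan (a + t) ≤ Real.arctan a + t := by
  have hmono : Monotone fun x => x - Real.arctan x := by
    refine monotone_of_deriv_nonneg (differentiable_id.sub Real.differentiable_arctan)
      fun x => ?_
    have := ((hasDerivAt_id x).sub (Real.hasDerivAt_arctan' x)).deriv
    change 0 ≤ deriv (id - Real.arctan) x
    rw [this, sub_nonneg]
    exact inv_le_one_of_one_le₀ (by nlinarith [sq_nonneg x])
  have := hmono (show a ≤ a + t by linarith)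
  simp only at this
  linarith

/-- Adding `t` times the identity changes the phase by at most `n t`. -/
theorem formPhase_le_of_le_add {b b' : 𝔼 →L[ℝ] 𝔼 →L[ℝ] ℝ} (hb : ∀ h k, b h k = b k h)
    (hb' : ∀ h k, b' h k = b' k h) {t : ℝ} (ht : 0 ≤ t)
    (hle : ∀ x, b x x ≤ b' x x + t * ‖x‖ ^ 2) : formPhase b ≤ formPhase b' + n * t := by
  obtain ⟨e, d, rfl⟩ := exists_eq_diagForm hb'
  calc formPhase b ≤ formPhase (diagForm e fun i => d i + t) := by
        refine formPhase_mono hb (diagForm_comm _ _) fun x => (hle x).trans_eq ?_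
        rw [← real_inner_self_eq_norm_sq, ← diagForm_const e, diagForm_apply, diagForm_apply,
          diagForm_apply, ← Finset.sum_add_distrib]
        exact Finset.sum_congr rfl fun i _ => by ring
    _ = ∑ i, Real.arctan (d i + t) := formPhase_diagForm _ _
    _ ≤ ∑ i, (Real.arctan (d i) + t) := Finset.sum_le_sum fun i _ => arctan_add_le ht
    _ = _ := by simp [Finset.sum_add_distrib, formPhase_diagForm]

/-- Rotation by `π/4` lowers the angle of a line of slope `(d - c)/s` by `π/4`. -/
theorem arctan_rotate {d : ℝ} (hd : 0 < d) :
    Real.arctan ((Real.cos (Real.pi / 4) - d⁻¹) / Real.sin (Real.pi / 4)) =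
      Real.arctan ((d - Real.cos (Real.pi / 4)) / Real.sin (Real.pi / 4)) - Real.pi / 4 := by
  rw [Real.cos_pi_div_four, Real.sin_pi_div_four]
  have h2 : √2 * √2 = 2 := Real.mul_self_sqrt (by norm_num)
  have hs : 0 < √2 := by positivity
  have e1 : (√2 / 2 - d⁻¹) / (√2 / 2) = 1 - √2 / d := by
    field_simp
    nlinarith
  have e2 : (d - √2 / 2) / (√2 / 2) = √2 * d - 1 := by
    field_simp
    nlinarith
  -- Positivity of `d` enters here: it keeps the addition formula for arctan on the principal
  -- branch.
  have hlt : (1 - √2 / d) * 1 < 1 := by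
    have : 0 < √2 / d := by positivity
    linarith
  rw [e1, e2, eq_sub_iff_add_eq, ← Real.arctan_one, Real.arctan_add hlt]
  congr 1
  have : 1 - (1 - √2 / d) * 1 = √2 / d := by ring
  rw [this]
  field_simp
  nlinarith

/-! ### Subgradients and the Legendre transform -/

/-- A convex function has a subgradient at every point of its open domain. -/
theorem ConvexOn.exists_mem_subdifferential {Ω : Set 𝔼} (hΩ : IsOpen Ω) {f : 𝔼 → ℝ}
    (hf : ConvexOn ℝ Ω f) {x : 𝔼} (hx : x ∈ Ω) : ∃ y, y ∈ subdifferential Ω f x := by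
  have hcont : ContinuousOn f Ω := hf.continuousOn hΩ
  set S : Set (𝔼 × ℝ) := {p | p.1 ∈ Ω ∧ f p.1 < p.2}
  have hSo : IsOpen S := by
    have h : ContinuousOn (fun p : 𝔼 × ℝ => p.2 - f p.1) (Prod.fst ⁻¹' Ω) :=
      continuousOn_snd.sub (hcont.comp continuousOn_fst fun p hp => hp)
    have := h.isOpen_inter_preimage (hΩ.preimage continuous_fst) (isOpen_Ioi (a := (0 : ℝ)))
    convert this using 1
    ext p
    simp [S]
  obtain ⟨L, hL⟩ := geometric_hahn_banach_open_point hf.convex_strict_epigraph hSo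
    (show (x, f x) ∉ S from fun h => lt_irrefl _ h.2)
  have hsplit : ∀ (z : 𝔼) (t : ℝ), L (z, t) = L (z, 0) + t * L (0, 1) := by
    intro z t
    have : ((z, t) : 𝔼 × ℝ) = (z, 0) + t • ((0 : 𝔼), (1 : ℝ)) := by simp
    rw [this, map_add, map_smul, smul_eq_mul]
  set α := L (0, 1)
  -- The separating hyperplane is not vertical, so it can be normalized to the graph of an affine
  -- function.
  have hα : α < 0 := by
    have := hL (x, f x + 1) ⟨hx, by simp⟩
    rw [hsplit x (f x + 1), hsplit x (f x)] at this
    linarith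
  set g : 𝔼 →L[ℝ] ℝ := (-α)⁻¹ • L.comp (ContinuousLinearMap.inl ℝ 𝔼 ℝ)
  refine ⟨(InnerProductSpace.toDual ℝ 𝔼).symm g, fun z hz => ?_⟩
  rw [InnerProductSpace.toDual_symm_apply]
  have hle : L (z, 0) + f z * α ≤ L (x, 0) + f x * α := by
    refine le_of_forall_pos_lt_add fun ε hε => ?_
    have := hL (z, f z + ε / (-α)) ⟨hz, by simpa using div_pos hε (neg_pos.mpr hα)⟩
    rw [hsplit z (f z + _), hsplit x (f x), add_mul] at this
    have h2 : ε / (-α) * α = -ε := by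
      rw [div_mul_eq_mul_div, div_neg, mul_div_cancel_right₀ _ hα.ne]
    linarith
  have hg : g (z - x) = (-α)⁻¹ * (L (z, 0) - L (x, 0)) := by
    simp only [g, smul_apply, ContinuousLinearMap.comp_apply,
      ContinuousLinearMap.inl_apply, smul_eq_mul]
    rw [← map_sub]
    simp
  rw [hg]
  have : (-α)⁻¹ * (L (z, 0) - L (x, 0)) ≤ (-α)⁻¹ * ((-α) * (f z - f x)) :=
    mul_le_mul_of_nonneg_left (by linarith) (inv_nonneg.mpr (by linarith))
  rw [inv_mul_cancel_left₀ (by linarith)] at this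
  linarith

theorem legendre_eq_of_mem_subdifferential {Ω : Set 𝔼} {f : 𝔼 → ℝ} {x y : 𝔼} (hx : x ∈ Ω)
    (hy : y ∈ subdifferential Ω f x) : legendre Ω f y = ⟪x, y⟫ - f x := by
  have h := isGreatest_legendre hx hy
  refine le_antisymm ?_ (h.2 ⟨x, hx, rfl⟩)
  obtain ⟨z, hz, hze⟩ := h.1
  rw [← hze]
  have h1 := hy z hz
  rw [inner_sub_right, real_inner_comm z y, real_inner_comm x y] at h1
  change ⟪z, y⟫ - f z ≤ _
  linarith

theorem mem_subdifferential_iff_isMinOn {Ω : Set 𝔼} {f : 𝔼 → ℝ} {x y : 𝔼} :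
    y ∈ subdifferential Ω f x ↔ IsMinOn (fun z => f z - ⟪y, z⟫) Ω x := by
  refine forall₂_congr fun z _ => ?_
  change _ ↔ f x - ⟪y, x⟫ ≤ f z - ⟪y, z⟫
  rw [inner_sub_right]
  constructor <;> intro h <;> linarith

theorem IsCompact.exists_mem_subdifferential {K : Set 𝔼} (hK : IsCompact K) (hne : K.Nonempty)
    {f : 𝔼 → ℝ} (hf : ContinuousOn f K) (y : 𝔼) : ∃ x ∈ K, y ∈ subdifferential K f x := by
  simp only [mem_subdifferential_iff_isMinOn]
  exact hK.exists_isMinOn hne (hf.sub (by fun_prop))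

/-- The set of all subgradients. -/
def subgradientImage (Ω : Set 𝔼) (f : 𝔼 → ℝ) : Set 𝔼 := ⋃ x ∈ Ω, subdifferential Ω f x

theorem mem_subgradientImage {Ω : Set 𝔼} {f : 𝔼 → ℝ} {y : 𝔼} :
    y ∈ subgradientImage Ω f ↔ ∃ x ∈ Ω, y ∈ subdifferential Ω f x := by
  simp [subgradientImage]

/-- The Fenchel inequality. -/
theorem inner_le_add_legendre {Ω : Set 𝔼} {f : 𝔼 → ℝ} {y z : 𝔼} (hy : y ∈ subgradientImage Ω f)
    (hz : z ∈ Ω) : ⟪z, y⟫ ≤ f z + legendre Ω f y := by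
  obtain ⟨x, hx, hxy⟩ := mem_subgradientImage.mp hy
  -- Attainment makes the set bounded above; on an unbounded set `sSup` would take its default value
  -- 0.
  have := (isGreatest_legendre hx hxy).2 ⟨z, hz, rfl⟩
  simp only at this
  linarith

/-! ### Strong convexity and regularity of the Legendre transform -/

section StrongConvex

variable {Ω : Set (EuclideanSpace ℝ (Fin n))} {F : EuclideanSpace ℝ (Fin n) → ℝ} {m : ℝ}

/-- On the segment from x to z, the subgradient inequality and strong convexity give the estimate
with a factor 1 - t in the quadratic term; then t → 0. -/
theorem StrongConvexOn.add_sq_le (hF : StrongConvexOn Ω m F) {x y z : 𝔼}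
    (hx : x ∈ Ω) (hy : y ∈ subdifferential Ω F x) (hz : z ∈ Ω) :
    F x + ⟪y, z - x⟫ + m / 2 * ‖z - x‖ ^ 2 ≤ F z := by
  have key : ∀ t : ℝ, 0 < t → t < 1 →
      F x + ⟪y, z - x⟫ + (1 - t) * (m / 2 * ‖z - x‖ ^ 2) ≤ F z := by
    intro t ht ht1
    have h1 := hF.2 hz hx ht.le (by linarith : 0 ≤ 1 - t) (by ring)
    have h2 := hy _ (hF.1 hz hx ht.le (by linarith : 0 ≤ 1 - t) (by ring))
    have h3 : t • z + (1 - t) • x - x = t • (z - x) := by module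
    rw [h3, inner_smul_right] at h2
    simp only [smul_eq_mul] at h1
    have h4 : t * (F x + ⟪y, z - x⟫ + (1 - t) * (m / 2 * ‖z - x‖ ^ 2)) ≤ t * F z := by
      nlinarith
    exact le_of_mul_le_mul_left h4 ht
  have hlim : Tendsto (fun t : ℝ => F x + ⟪y, z - x⟫ + (1 - t) * (m / 2 * ‖z - x‖ ^ 2))
      (𝓝[>] 0) (𝓝 (F x + ⟪y, z - x⟫ + (1 - 0) * (m / 2 * ‖z - x‖ ^ 2))) := by
    refine Tendsto.mono_left (Continuous.tendsto ?_ 0) nhdsWithin_le_nhds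
    fun_prop
  rw [sub_zero, one_mul] at hlim
  refine le_of_tendsto hlim ?_
  filter_upwards [Ioo_mem_nhdsGT (zero_lt_one' ℝ)] with t ht
  exact key t ht.1 ht.2

/-- Adding the quadratic growth at both points gives strong monotonicity of the subdifferential; its
inverse is therefore single-valued and Lipschitz. -/
theorem StrongConvexOn.norm_sub_le (hF : StrongConvexOn Ω m F) {x₁ x₂ y₁ y₂ : 𝔼}
    (hx₁ : x₁ ∈ Ω) (hx₂ : x₂ ∈ Ω) (hy₁ : y₁ ∈ subdifferential Ω F x₁)
    (hy₂ : y₂ ∈ subdifferential Ω F x₂) : m * ‖x₁ - x₂‖ ≤ ‖y₁ - y₂‖ := by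
  have h1 := hF.add_sq_le hx₁ hy₁ hx₂
  have h2 := hF.add_sq_le hx₂ hy₂ hx₁
  have h3 : m * ‖x₁ - x₂‖ ^ 2 ≤ ⟪y₁ - y₂, x₁ - x₂⟫ := by
    rw [inner_sub_left]
    rw [← neg_sub x₁ x₂, inner_neg_right, norm_neg] at h1
    linarith
  have h4 := h3.trans (real_inner_le_norm _ _)
  rcases (norm_nonneg (x₁ - x₂)).eq_or_lt with h | h
  · rw [← h, mul_zero]; exact norm_nonneg _
  · refine le_of_mul_le_mul_right ?_ h
    nlinarith

/-- Slopes close to a subgradient at `x₀` are subgradients at points close to `x₀`. -/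
theorem StrongConvexOn.exists_mem_subdifferential_of_norm_lt (hF : StrongConvexOn Ω m F)
    (hm : 0 < m) (hcont : ContinuousOn F Ω) {x₀ y₀ y : 𝔼} {r : ℝ} (hr : 0 < r)
    (hball : closedBall x₀ r ⊆ Ω) (hy₀ : y₀ ∈ subdifferential Ω F x₀)
    (hy : ‖y - y₀‖ < m * r / 2) : ∃ x ∈ closedBall x₀ r, y ∈ subdifferential Ω F x := by
  have hx₀ : x₀ ∈ closedBall x₀ r := mem_closedBall_self hr.le
  obtain ⟨x, hx, hmin⟩ := (isCompact_closedBall x₀ r).exists_isMinOn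
    (f := fun z => F z - ⟪y, z⟫) ⟨x₀, hx₀⟩ ((hcont.mono hball).sub (by fun_prop))
  have hxΩ := hball hx
  refine ⟨x, hx, mem_subdifferential_iff_isMinOn.mpr ?_⟩
  -- On the sphere of radius `r` the growth m r²/2 beats the tilt ‖y - y₀‖ r, so the minimizer is
  -- interior; by convexity it then minimizes over all of Ω.
  have hlt : dist x x₀ < r := by
    refine lt_of_le_of_ne hx fun heq => ?_
    rw [dist_eq_norm] at heq
    have h1 := hF.add_sq_le (hball hx₀) hy₀ hxΩ
    have h2 : F x - ⟪y, x⟫ ≤ F x₀ - ⟪y, x₀⟫ := hmin hx₀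
    have h3 : ⟪y - y₀, x - x₀⟫ ≤ ‖y - y₀‖ * r := heq ▸ real_inner_le_norm _ _
    rw [inner_sub_left, inner_sub_right y] at h3
    rw [heq] at h1
    nlinarith
  have hloc : IsLocalMinOn (fun z => F z - ⟪y, z⟫) Ω x := by
    have : ∀ᶠ z in 𝓝 x, z ∈ closedBall x₀ r :=
      mem_of_superset (isOpen_ball.mem_nhds (mem_ball.mpr hlt)) ball_subset_closedBall
    exact (this.mono fun z hz => hmin hz).filter_mono nhdsWithin_le_nhds
  refine IsMinOn.of_isLocalMinOn_of_convexOn hxΩ hloc ?_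
  refine (hF.convexOn fun t => by positivity).sub ?_
  exact ((innerSL ℝ y).toLinearMap.concaveOn hF.1)

theorem StrongConvexOn.isOpen_subgradientImage (hF : StrongConvexOn Ω m F)
    (hm : 0 < m) (hΩ : IsOpen Ω) : IsOpen (subgradientImage Ω F) := by
  have hcont := (hF.convexOn fun t => by positivity).continuousOn hΩ
  refine isOpen_iff_mem_nhds.mpr fun y₀ hy₀ => ?_
  obtain ⟨x₀, hx₀, hy⟩ := mem_subgradientImage.mp hy₀
  obtain ⟨r, hr, hball⟩ := nhds_basis_closedBall.mem_iff.mp (hΩ.mem_nhds hx₀)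
  refine mem_of_superset (ball_mem_nhds y₀ (show 0 < m * r / 2 by positivity)) fun y hy' => ?_
  obtain ⟨x, hx, hxy⟩ := hF.exists_mem_subdifferential_of_norm_lt hm hcont hr hball hy
    (by rwa [← dist_eq_norm])
  exact mem_subgradientImage.mpr ⟨x, hball hx, hxy⟩

/-- Fenchel's inequality at (x, y') and (x', y) squeezes F*(y') - F*(y) - ⟪x, y' - y⟫ between 0 and
⟪x' - x, y' - y⟫, and x' - x is controlled by (y' - y)/m. -/
theorem StrongConvexOn.hasGradientAt_legendre (hF : StrongConvexOn Ω m F)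
    (hm : 0 < m) (hΩ : IsOpen Ω) {x y : 𝔼} (hx : x ∈ Ω) (hy : y ∈ subdifferential Ω F x) :
    HasGradientAt (legendre Ω F) x y := by
  have hyD : y ∈ subgradientImage Ω F := mem_subgradientImage.mpr ⟨x, hx, hy⟩
  rw [hasGradientAt_iff_isLittleO, Asymptotics.isLittleO_iff]
  intro ε hε
  filter_upwards [(hF.isOpen_subgradientImage hm hΩ).mem_nhds hyD,
    ball_mem_nhds y (show 0 < ε * m by positivity)] with y' hy' hball
  obtain ⟨x', hx', hxy'⟩ := mem_subgradientImage.mp hy'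
  have h1 := inner_le_add_legendre hy' hx
  have h2 := inner_le_add_legendre hyD hx'
  have e1 := legendre_eq_of_mem_subdifferential hx hy
  have e2 := legendre_eq_of_mem_subdifferential hx' hxy'
  have h3 := hF.norm_sub_le hx' hx hxy' hy
  have h4 := real_inner_le_norm (x' - x) (y' - y)
  rw [mem_ball, dist_eq_norm] at hball
  have h5 : ‖x' - x‖ ≤ ε := by
    refine le_of_mul_le_mul_left (h3.trans (hball.le.trans_eq ?_)) hm
    ring
  have h6 := mul_le_mul_of_nonneg_right h5 (norm_nonneg (y' - y))
  rw [inner_sub_left, inner_sub_right, inner_sub_right] at h4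
  rw [Real.norm_eq_abs, abs_le, inner_sub_right]
  constructor
  · have : 0 ≤ ε * ‖y' - y‖ := by positivity
    linarith
  · linarith

theorem StrongConvexOn.gradient_legendre (hF : StrongConvexOn Ω m F)
    (hm : 0 < m) (hΩ : IsOpen Ω) {x y : 𝔼} (hx : x ∈ Ω) (hy : y ∈ subdifferential Ω F x) :
    gradient (legendre Ω F) y = x :=
  (hF.hasGradientAt_legendre hm hΩ hx hy).gradient

theorem StrongConvexOn.lipschitzOnWith_gradient_legendre (hF : StrongConvexOn Ω m F)
    (hm : 0 < m) (hΩ : IsOpen Ω) :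
    LipschitzOnWith (m⁻¹).toNNReal (gradient (legendre Ω F)) (subgradientImage Ω F) := by
  refine LipschitzOnWith.of_dist_le_mul fun y hy y' hy' => ?_
  obtain ⟨x, hx, hxy⟩ := mem_subgradientImage.mp hy
  obtain ⟨x', hx', hxy'⟩ := mem_subgradientImage.mp hy'
  rw [hF.gradient_legendre hm hΩ hx hxy, hF.gradient_legendre hm hΩ hx' hxy',
    Real.coe_toNNReal _ (by positivity), dist_eq_norm, dist_eq_norm, ← div_eq_inv_mul,
    le_div_iff₀' hm]
  exact hF.norm_sub_le hx hx' hxy hxy'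

end StrongConvex

/-! ### Second-order Taylor expansions -/

/-- Second-order Taylor expansion, with Peano remainder. -/
theorem eventually_abs_taylor_two_le {f : 𝔼 → ℝ} {f' : 𝔼 → 𝔼 →L[ℝ] ℝ} {f'' : 𝔼 →L[ℝ] 𝔼 →L[ℝ] ℝ}
    {x : 𝔼} (hf : ∀ᶠ y in 𝓝 x, HasFDerivAt f (f' y) y) (hx : HasFDerivAt f' f'' x)
    {ε : ℝ} (hε : 0 < ε) :
    ∀ᶠ h in 𝓝 (0 : 𝔼), |f (x + h) - f x - f' x h - f'' h h / 2| ≤ ε * ‖h‖ ^ 2 := by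
  have hsymm : ∀ v w, f'' v w = f'' w v := second_derivative_symmetric_of_eventually hf hx
  have hshift : Tendsto (fun h : 𝔼 => x + h) (𝓝 0) (𝓝 x) := by
    have : Continuous fun h : 𝔼 => x + h := by fun_prop
    simpa using this.tendsto 0
  have h1 : ∀ᶠ h in 𝓝 (0 : 𝔼), HasFDerivAt f (f' (x + h)) (x + h) := hshift.eventually hf
  have h2 : ∀ᶠ h in 𝓝 (0 : 𝔼), ‖f' (x + h) - f' x - f'' h‖ ≤ ε * ‖h‖ :=
    (hasFDerivAt_iff_isLittleO_nhds_zero.mp hx).def hε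
  obtain ⟨δ, hδ, hball⟩ := Metric.eventually_nhds_iff_ball.mp (h1.and h2)
  filter_upwards [ball_mem_nhds 0 hδ] with h hh
  -- The mean value inequality is applied to the remainder itself. Only differentiability of `f'` at
  -- `x` is used, since the gradient of a Legendre transform is in general merely Lipschitz.
  have hderiv : ∀ k ∈ closedBall (0 : 𝔼) ‖h‖, HasFDerivWithinAt
      (fun k => f (x + k) - f' x k - f'' k k / 2) (f' (x + k) - f' x - f'' k)
      (closedBall (0 : 𝔼) ‖h‖) k := by
    intro k hk
    have hkδ : k ∈ ball (0 : 𝔼) δ := by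
      rw [mem_ball_zero_iff] at hh ⊢
      exact (mem_closedBall_zero_iff.mp hk).trans_lt hh
    have d1 : HasFDerivAt (fun k => f (x + k)) (f' (x + k)) k :=
      (hasFDerivAt_comp_add_left x).mpr (hball k hkδ).1
    have d2 : HasFDerivAt (fun k => f'' k k) (f'' k + f''.flip k) k := by
      have := (f''.hasFDerivAt (x := k)).clm_apply (hasFDerivAt_id k)
      refine this.congr_fderiv ?_
      ext v
      simp
    have d3 := ((d1.sub (f' x).hasFDerivAt).sub (d2.const_mul (1 / 2 : ℝ))).hasFDerivWithinAt
      (s := closedBall (0 : 𝔼) ‖h‖)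
    refine (d3.congr_fderiv ?_).congr_of_eventuallyEq (Eventually.of_forall fun k => ?_) ?_
    · ext v
      simp [hsymm v k]
      ring
    · simp; ring
    · simp; ring
  have hbound : ∀ k ∈ closedBall (0 : 𝔼) ‖h‖, ‖f' (x + k) - f' x - f'' k‖ ≤ ε * ‖h‖ := by
    intro k hk
    have hk' := mem_closedBall_zero_iff.mp hk
    have hkδ : k ∈ ball (0 : 𝔼) δ := by
      rw [mem_ball_zero_iff] at hh ⊢
      exact hk'.trans_lt hh
    exact (hball k hkδ).2.trans (by gcongr)
  have := (convex_closedBall (0 : 𝔼) ‖h‖).norm_image_sub_le_of_norm_hasFDerivWithin_le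
    hderiv hbound (mem_closedBall_self (norm_nonneg h)) (mem_closedBall_zero_iff.mpr le_rfl)
  simp only [add_zero, map_zero, sub_zero, zero_div] at this
  rw [Real.norm_eq_abs] at this
  calc |f (x + h) - f x - f' x h - f'' h h / 2|
      = |f (x + h) - f' x h - f'' h h / 2 - f x| := by congr 1; ring
    _ ≤ _ := this
    _ = _ := by ring

/-- Second-order Taylor expansion of a `C²` function. -/
theorem ContDiffAt.eventually_abs_taylor_two_le {f : 𝔼 → ℝ} {x : 𝔼} (hf : ContDiffAt ℝ 2 f x)
    {ε : ℝ} (hε : 0 < ε) : ∀ᶠ h in 𝓝 (0 : 𝔼),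
      |f (x + h) - f x - fderiv ℝ f x h - fderiv ℝ (fderiv ℝ f) x h h / 2| ≤ ε * ‖h‖ ^ 2 := by
  refine _root_.eventually_abs_taylor_two_le ?_ ?_ hε
  · filter_upwards [hf.eventually (by simp)] with y hy
    exact (hy.differentiableAt (by simp)).hasFDerivAt
  · exact ((hf.fderiv_right (m := 1) (by norm_num)).differentiableAt (by simp)).hasFDerivAt

theorem ContDiffAt.fderiv_fderiv_symm {f : 𝔼 → ℝ} {x : 𝔼} (hf : ContDiffAt ℝ 2 f x) (h k : 𝔼) :
    fderiv ℝ (fderiv ℝ f) x h k = fderiv ℝ (fderiv ℝ f) x k h :=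
  (hf.isSymmSndFDerivAt (by simp)).eq h k

/-! ### Quadratic bounds under Legendre duality -/

/-- The inner product as a bilinear form. -/
def innerForm (n : ℕ) :
    EuclideanSpace ℝ (Fin n) →L[ℝ] EuclideanSpace ℝ (Fin n) →L[ℝ] ℝ := innerSL ℝ

@[simp]
theorem innerForm_apply (h k : 𝔼) : innerForm n h k = ⟪h, k⟫ := rfl

/-- The symmetric operator with eigenbasis `e` and eigenvalues `d`. -/
def diagMap (e : OrthonormalBasis (Fin n) ℝ 𝔼) (d : Fin n → ℝ) : 𝔼 →L[ℝ] 𝔼 :=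
  ∑ i, d i • (innerSL ℝ (e i)).smulRight (e i)

theorem inner_diagMap (e : OrthonormalBasis (Fin n) ℝ 𝔼) (d : Fin n → ℝ) (i : Fin n) (h : 𝔼) :
    ⟪e i, diagMap e d h⟫ = d i * ⟪e i, h⟫ := by
  simp only [diagMap, sum_apply, smul_apply,
    ContinuousLinearMap.smulRight_apply, innerSL_apply_apply, inner_sum, inner_smul_right]
  rw [Finset.sum_eq_single i]
  · simp
  · intro j _ hj
    simp [e.inner_eq_zero hj.symm]
  · simp

theorem inner_self_diagMap (e : OrthonormalBasis (Fin n) ℝ 𝔼) (d : Fin n → ℝ) (h : 𝔼) :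
    ⟪h, diagMap e d h⟫ = diagForm e d h h := by
  rw [← e.sum_inner_mul_inner, diagForm_apply]
  refine Finset.sum_congr rfl fun i _ => ?_
  rw [inner_diagMap, real_inner_comm]
  ring

theorem diagForm_diagMap_inv (e : OrthonormalBasis (Fin n) ℝ 𝔼) {d : Fin n → ℝ}
    (hd : ∀ i, 0 < d i) (h : 𝔼) :
    diagForm e d (diagMap e d⁻¹ h) (diagMap e d⁻¹ h) = diagForm e d⁻¹ h h := by
  rw [diagForm_apply, diagForm_apply]
  refine Finset.sum_congr rfl fun i _ => ?_
  rw [inner_diagMap, Pi.inv_apply]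
  have := (hd i).ne'
  field_simp

/-- The Fenchel inequality for a positive definite quadratic form. -/
theorem inner_le_diagForm_add (e : OrthonormalBasis (Fin n) ℝ 𝔼) {d : Fin n → ℝ}
    (hd : ∀ i, 0 < d i) (h k : 𝔼) :
    ⟪h, k⟫ ≤ diagForm e d k k / 2 + diagForm e d⁻¹ h h / 2 := by
  rw [← e.sum_inner_mul_inner h k, diagForm_apply, diagForm_apply, Finset.sum_div, Finset.sum_div,
    ← Finset.sum_add_distrib]
  refine Finset.sum_le_sum fun i _ => ?_
  rw [real_inner_comm (e i) h, Pi.inv_apply]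
  have h1 := hd i
  have h2 : 0 ≤ (d i)⁻¹ * (d i * ⟪e i, k⟫ - ⟪e i, h⟫) ^ 2 := by positivity
  have h3 : (d i)⁻¹ * (d i * ⟪e i, k⟫ - ⟪e i, h⟫) ^ 2 =
      d i * (⟪e i, k⟫ * ⟪e i, k⟫) + (d i)⁻¹ * (⟪e i, h⟫ * ⟪e i, h⟫) -
        2 * (⟪e i, h⟫ * ⟪e i, k⟫) := by
    field_simp
    ring
  linarith

theorem exists_pos_mul_sq_le_diagForm (e : OrthonormalBasis (Fin n) ℝ 𝔼) {d : Fin n → ℝ}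
    (hd : ∀ i, 0 < d i) : ∃ a > 0, ∀ k, a * ‖k‖ ^ 2 ≤ diagForm e d k k := by
  have hpos : 0 < 1 + ∑ i, (d i)⁻¹ :=
    add_pos_of_pos_of_nonneg one_pos (Finset.sum_nonneg fun i _ => (inv_pos.mpr (hd i)).le)
  -- An explicit positive lower bound for all `d i`, meaningful also for n = 0.
  refine ⟨(1 + ∑ i, (d i)⁻¹)⁻¹, inv_pos.mpr hpos, fun k => ?_⟩
  rw [← real_inner_self_eq_norm_sq, ← diagForm_const e, diagForm_apply, diagForm_apply]
  refine Finset.sum_le_sum fun i _ => mul_le_mul_of_nonneg_right ?_ (mul_self_nonneg _)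
  rw [inv_le_comm₀ hpos (hd i)]
  have := Finset.single_le_sum (f := fun i => (d i)⁻¹) (fun i _ => (inv_pos.mpr (hd i)).le)
    (Finset.mem_univ i)
  linarith

theorem tendsto_add_nhds_zero (x : 𝔼) : Tendsto (fun h : 𝔼 => x + h) (𝓝 0) (𝓝 x) := by
  have : Continuous fun h : 𝔼 => x + h := by fun_prop
  simpa using this.tendsto 0

/-- An upper quadratic bound for the Legendre transform gives a lower quadratic bound, with the
inverse form, for the function. -/
theorem eventually_le_of_legendre_le {Ω : Set 𝔼} {F : 𝔼 → ℝ} {x y : 𝔼} (hΩ : IsOpen Ω)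
    (hD : IsOpen (subgradientImage Ω F)) (hx : x ∈ Ω) (hy : y ∈ subdifferential Ω F x)
    (e : OrthonormalBasis (Fin n) ℝ 𝔼) {d : Fin n → ℝ} (hd : ∀ i, 0 < d i) {ε : ℝ} (hε : 0 ≤ ε)
    (h : ∀ᶠ k in 𝓝 (0 : 𝔼), legendre Ω F (y + k) ≤
      legendre Ω F y + ⟪x, k⟫ + diagForm e d k k / 2 + ε * ‖k‖ ^ 2) :
    ∀ᶠ h in 𝓝 (0 : 𝔼), F x + ⟪y, h⟫ + diagForm e d⁻¹ h h / 2 -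
      ε * ‖diagMap e d⁻¹‖ ^ 2 * ‖h‖ ^ 2 ≤ F (x + h) := by
  have hyD : y ∈ subgradientImage Ω F := mem_subgradientImage.mpr ⟨x, hx, hy⟩
  have hL : Tendsto (fun h : 𝔼 => diagMap e d⁻¹ h) (𝓝 0) (𝓝 0) := by
    simpa using (diagMap e d⁻¹).continuous.tendsto 0
  filter_upwards [(tendsto_add_nhds_zero x).eventually (hΩ.mem_nhds hx),
    ((tendsto_add_nhds_zero y).comp hL).eventually (hD.mem_nhds hyD), hL.eventually h]
    with h h1 h2 h3
  simp only [Function.comp_apply] at h2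
  -- This `k` maximizes ⟪h, k⟫ - `diagForm e d k k` / 2, so Fenchel's inequality at slope y + k
  -- gives the optimal bound.
  set k := diagMap e d⁻¹ h
  have h4 := inner_le_add_legendre h2 h1
  have h5 := legendre_eq_of_mem_subdifferential hx hy
  have h6 : ⟪h, k⟫ = diagForm e d⁻¹ h h := inner_self_diagMap e d⁻¹ h
  rw [diagForm_diagMap_inv e hd] at h3
  have h7 : ‖k‖ ^ 2 ≤ ‖diagMap e d⁻¹‖ ^ 2 * ‖h‖ ^ 2 := by
    rw [← mul_pow]
    gcongr
    exact (diagMap e d⁻¹).le_opNorm h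
  have h8 := mul_le_mul_of_nonneg_left h7 hε
  rw [inner_add_left, inner_add_right, inner_add_right, h6, real_inner_comm y h] at h4
  linarith

/-- A lower quadratic bound for the Legendre transform gives an upper quadratic bound, with the
inverse form, for the function. -/
theorem eventually_le_of_le_legendre {Ω : Set 𝔼} {F : 𝔼 → ℝ} {x y : 𝔼} (hΩ : IsOpen Ω)
    (hF : ConvexOn ℝ Ω F)
    (hD : IsOpen (subgradientImage Ω F)) (hx : x ∈ Ω) (hy : y ∈ subdifferential Ω F x)
    (e : OrthonormalBasis (Fin n) ℝ 𝔼) {d : Fin n → ℝ} (hd : ∀ i, 0 < d i)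
    (h : ∀ ε > 0, ∀ᶠ k in 𝓝 (0 : 𝔼), legendre Ω F y + ⟪x, k⟫ + diagForm e d k k / 2 -
      ε * ‖k‖ ^ 2 ≤ legendre Ω F (y + k)) {ε : ℝ} (hε : 0 < ε) :
    ∀ᶠ h in 𝓝 (0 : 𝔼), F (x + h) ≤ F x + ⟪y, h⟫ + diagForm e d⁻¹ h h / 2 + ε * ‖h‖ ^ 2 := by
  have hyD : y ∈ subgradientImage Ω F := mem_subgradientImage.mpr ⟨x, hx, hy⟩
  have e1 := legendre_eq_of_mem_subdifferential hx hy
  obtain ⟨a, ha, hda⟩ := exists_pos_mul_sq_le_diagForm e hd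
  -- The tolerance a/4 leaves quadratic growth a/4 of F* around `y`. The tolerance ε(a/4)² serves
  -- the final estimate, where (a/4)‖k‖ ≤ ‖h‖.
  obtain ⟨δ, hδ, hball⟩ := Metric.eventually_nhds_iff_ball.mp
    (((h (a / 4) (by positivity)).and (h (ε * (a / 4) ^ 2) (by positivity))).and
      ((tendsto_add_nhds_zero y).eventually (hD.mem_nhds hyD)))
  -- monotonicity of the subdifferential against the slopes near `y`
  have grow : ∀ k ∈ ball (0 : 𝔼) δ, ∀ x' ∈ Ω, y + k ∈ subdifferential Ω F x' →
      a / 4 * ‖k‖ ^ 2 ≤ ⟪x' - x, k⟫ := by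
    intro k hk x' hx' hxy'
    obtain ⟨⟨h1, -⟩, -⟩ := hball k hk
    have h3 := inner_le_add_legendre hyD hx'
    have h4 := legendre_eq_of_mem_subdifferential hx' hxy'
    have h5 := hda k
    rw [inner_add_right] at h4
    rw [inner_sub_left]
    linarith
  have mono : ∀ {x₁ x₂ y₁ y₂ : 𝔼}, x₁ ∈ Ω → x₂ ∈ Ω → y₁ ∈ subdifferential Ω F x₁ →
      y₂ ∈ subdifferential Ω F x₂ → 0 ≤ ⟪x₁ - x₂, y₁ - y₂⟫ := by
    intro x₁ x₂ y₁ y₂ h1 h2 h3 h4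
    have h5 := h3 x₂ h2
    have h6 := h4 x₁ h1
    rw [real_inner_comm, inner_sub_left]
    rw [← neg_sub x₁ x₂, inner_neg_right] at h5
    linarith
  filter_upwards [(tendsto_add_nhds_zero x).eventually (hΩ.mem_nhds hx),
    ball_mem_nhds (0 : 𝔼) (show 0 < a / 4 * (δ / 2) by positivity)] with h hxh hh
  rw [mem_ball_zero_iff] at hh
  -- F(x + h) is recovered from a subgradient y + k there. The bound on F* is only local, so `k`
  -- must first be shown small: otherwise monotonicity against the slope y + t k at distance δ/2
  -- from `y` would force ‖h‖ to be large.
  obtain ⟨y', hy'⟩ := hF.exists_mem_subdifferential hΩ hxh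
  obtain ⟨k, rfl⟩ : ∃ k, y' = y + k := ⟨y' - y, by abel⟩
  have hk : ‖k‖ < δ := by
    by_contra! hk
    have hkpos : 0 < ‖k‖ := by linarith
    set t := δ / 2 / ‖k‖
    have ht : 0 < t := by positivity
    have htk : ‖t • k‖ = δ / 2 := by
      rw [norm_smul, Real.norm_of_nonneg ht.le, div_mul_cancel₀ _ hkpos.ne']
    have ht1 : t < 1 := (div_lt_one hkpos).mpr (by linarith)
    have htball : t • k ∈ ball (0 : 𝔼) δ := by
      rw [mem_ball_zero_iff, htk]
      linarith
    obtain ⟨x', hx', hxy'⟩ := mem_subgradientImage.mp (hball _ htball).2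
    have hg := grow (t • k) htball x' hx' hxy'
    have h1 := mono hxh hx' hy' hxy'
    have h2 : y + k - (y + t • k) = (1 - t) • k := by module
    rw [h2, inner_smul_right] at h1
    have h3 : ⟪x' - x, t • k⟫ ≤ ⟪h, t • k⟫ := by
      have h4 : 0 ≤ ⟪x + h - x', k⟫ := nonneg_of_mul_nonneg_right h1 (by linarith)
      have h5 : x + h - x' = h - (x' - x) := by abel
      rw [h5, inner_sub_left] at h4
      rw [inner_smul_right, inner_smul_right]
      exact mul_le_mul_of_nonneg_left (by linarith) ht.le
    have h6 := (hg.trans h3).trans (real_inner_le_norm _ _)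
    rw [htk] at h6
    have : a / 4 * (δ / 2) ≤ ‖h‖ := by
      refine le_of_mul_le_mul_right ?_ (half_pos hδ)
      linarith
    linarith
  have hkh : a / 4 * ‖k‖ ≤ ‖h‖ := by
    have h1 := (grow k (by rwa [mem_ball_zero_iff]) _ hxh hy').trans (real_inner_le_norm _ _)
    rw [add_sub_cancel_left] at h1
    rcases (norm_nonneg k).eq_or_lt with h0 | h0
    · rw [← h0, mul_zero]; exact norm_nonneg h
    · refine le_of_mul_le_mul_right ?_ h0
      linarith
  obtain ⟨⟨-, h1⟩, -⟩ := hball k (by rwa [mem_ball_zero_iff])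
  have h2 := legendre_eq_of_mem_subdifferential hxh hy'
  have h3 := inner_le_diagForm_add e hd h k
  have h4 : ε * (a / 4) ^ 2 * ‖k‖ ^ 2 ≤ ε * ‖h‖ ^ 2 := by
    rw [mul_assoc, ← mul_pow]
    gcongr
  rw [inner_add_left, inner_add_right, inner_add_right, real_inner_comm y h] at h2
  linarith

/-! ### Alexandrov's theorem -/

/-- Every point of Ω is a value of the Lipschitz map X = ∇F*. The bad points are images under X of
its non-differentiability set, null by Rademacher, or critical values of X, null by Sard's lemma. -/
theorem StrongConvexOn.ae_hasFDerivAt_gradient_legendre {Ω : Set 𝔼} {F : 𝔼 → ℝ} {m : ℝ}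
    (hF : StrongConvexOn Ω m F) (hm : 0 < m) (hΩ : IsOpen Ω) :
    ∀ᵐ x, x ∈ Ω → ∃ y ∈ subdifferential Ω F x, ∃ T : 𝔼 →L[ℝ] 𝔼,
      HasFDerivAt (gradient (legendre Ω F)) T y ∧ T.det ≠ 0 := by
  set X := gradient (legendre Ω F)
  set D := subgradientImage Ω F
  have hDo : IsOpen D := hF.isOpen_subgradientImage hm hΩ
  have hLip : LipschitzOnWith (m⁻¹).toNNReal X D := hF.lipschitzOnWith_gradient_legendre hm hΩ
  have hnull : volume (X '' {y ∈ D | ¬ DifferentiableAt ℝ X y}) = 0 := by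
    have h1 : volume {y ∈ D | ¬ DifferentiableAt ℝ X y} = 0 := by
      refine measure_mono_null ?_ (ae_iff.mp (hLip.ae_differentiableWithinAt_of_mem (μ := volume)))
      rintro y ⟨hy, hy'⟩ hcon
      exact hy' ((hcon hy).differentiableAt (hDo.mem_nhds hy))
    -- Lipschitz maps preserve null sets of the n-dimensional Hausdorff measure, which are the
    -- Lebesgue null sets.
    have h2 := (hLip.mono (sep_subset D _)).hausdorffMeasure_image_le
      (d := Module.finrank ℝ 𝔼) (by positivity) (s := {y ∈ D | ¬ DifferentiableAt ℝ X y})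
    have h3 : Measure.hausdorffMeasure (Module.finrank ℝ 𝔼)
        {y ∈ D | ¬ DifferentiableAt ℝ X y} = 0 :=
      Measure.absolutelyContinuous_isAddHaarMeasure _ volume h1
    rw [h3, mul_zero] at h2
    exact Measure.absolutelyContinuous_isAddHaarMeasure volume
      (Measure.hausdorffMeasure (Module.finrank ℝ 𝔼)) (le_antisymm h2 zero_le)
  have hsard : volume (X '' {y ∈ D | DifferentiableAt ℝ X y ∧ (fderiv ℝ X y).det = 0}) = 0 :=
    addHaar_image_eq_zero_of_det_fderivWithin_eq_zero volume (f' := fderiv ℝ X)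
      (fun y hy => hy.2.1.hasFDerivAt.hasFDerivWithinAt) fun y hy => hy.2.2
  filter_upwards [compl_mem_ae_iff.mpr hnull, compl_mem_ae_iff.mpr hsard] with x h1 h2 hx
  obtain ⟨y, hy⟩ := (hF.convexOn fun t => by positivity).exists_mem_subdifferential hΩ hx
  have hyD : y ∈ D := mem_subgradientImage.mpr ⟨x, hx, hy⟩
  have hXy : X y = x := hF.gradient_legendre hm hΩ hx hy
  have hdiff : DifferentiableAt ℝ X y := by
    by_contra hcon
    exact h1 ⟨y, ⟨hyD, hcon⟩, hXy⟩
  exact ⟨y, hy, fderiv ℝ X y, hdiff.hasFDerivAt, fun hdet => h2 ⟨y, ⟨hyD, hdiff, hdet⟩, hXy⟩⟩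

/-- A strongly convex function has a second-order expansion at the points that its subdifferential
maps to regular points of the gradient of its Legendre transform. -/
theorem StrongConvexOn.exists_second_order {Ω : Set 𝔼} {F : 𝔼 → ℝ} {m : ℝ}
    (hF : StrongConvexOn Ω m F) (hm : 0 < m) (hΩ : IsOpen Ω) {x y : 𝔼} (hx : x ∈ Ω)
    (hy : y ∈ subdifferential Ω F x) {T : 𝔼 →L[ℝ] 𝔼}
    (hT : HasFDerivAt (gradient (legendre Ω F)) T y) (hdet : T.det ≠ 0) :
    ∃ b : 𝔼 →L[ℝ] 𝔼 →L[ℝ] ℝ, (∀ h k, b h k = b k h) ∧ ∀ ε > 0, ∀ᶠ h in 𝓝 (0 : 𝔼),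
      |F (x + h) - F x - ⟪y, h⟫ - b h h / 2| ≤ ε * ‖h‖ ^ 2 := by
  have hD := hF.isOpen_subgradientImage hm hΩ
  have hyD : y ∈ subgradientImage Ω F := mem_subgradientImage.mpr ⟨x, hx, hy⟩
  have hXy : gradient (legendre Ω F) y = x := hF.gradient_legendre hm hΩ hx hy
  have hf' : ∀ᶠ y' in 𝓝 y, HasFDerivAt (legendre Ω F)
      (innerSL ℝ (gradient (legendre Ω F) y')) y' := by
    filter_upwards [hD.mem_nhds hyD] with y' hy'
    obtain ⟨x', hx', hxy'⟩ := mem_subgradientImage.mp hy'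
    rw [hF.gradient_legendre hm hΩ hx' hxy']
    exact (hF.hasGradientAt_legendre hm hΩ hx' hxy').hasFDerivAt
  have hf'' : HasFDerivAt (fun y' => innerSL ℝ (gradient (legendre Ω F) y'))
      ((innerSL ℝ : 𝔼 →L[ℝ] 𝔼 →L[ℝ] ℝ).comp T) y :=
    (innerSL ℝ : 𝔼 →L[ℝ] 𝔼 →L[ℝ] ℝ).hasFDerivAt.comp y hT
  obtain ⟨e, d, hed⟩ := exists_eq_diagForm (second_derivative_symmetric_of_eventually hf' hf'')
  have taylor : ∀ ε > 0, ∀ᶠ k in 𝓝 (0 : 𝔼),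
      |legendre Ω F (y + k) - legendre Ω F y - ⟪x, k⟫ - diagForm e d k k / 2| ≤ ε * ‖k‖ ^ 2 := by
    intro ε hε
    have := eventually_abs_taylor_two_le hf' hf'' hε
    rw [hed, hXy] at this
    exact this
  -- F* lies above its tangent at `y`, by Fenchel's inequality at `x`; the expansion along `e i`
  -- then has nonnegative second-order coefficient.
  have hd0 : ∀ i, 0 ≤ d i := by
    intro i
    refine le_of_forall_pos_le_add fun ε hε => ?_
    have hlim : Tendsto (fun t : ℝ => t • e i) (𝓝[≠] 0) (𝓝 0) := by
      have : Continuous fun t : ℝ => t • e i := by fun_prop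
      have := this.tendsto 0
      rw [zero_smul] at this
      exact this.mono_left nhdsWithin_le_nhds
    obtain ⟨t, ⟨h1, h2⟩, h3⟩ := ((hlim.eventually ((taylor (ε / 2) (by positivity)).and
      ((tendsto_add_nhds_zero y).eventually (hD.mem_nhds hyD)))).and
      self_mem_nhdsWithin).exists
    have h4 := inner_le_add_legendre h2 hx
    have h5 := legendre_eq_of_mem_subdifferential hx hy
    rw [inner_add_right] at h4
    have h6 : diagForm e d (t • e i) (t • e i) = t ^ 2 * d i := by
      rw [map_smul, map_smul, smul_apply, diagForm_basis]
      simp only [smul_eq_mul]; ring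
    have h7 : ‖t • e i‖ ^ 2 = t ^ 2 := by
      rw [norm_smul, e.norm_eq_one, mul_one, Real.norm_eq_abs, sq_abs]
    rw [h6, h7] at h1
    have h8 := (abs_le.mp h1).2
    have h9 : 0 < t ^ 2 := by
      have : t ≠ 0 := h3
      positivity
    refine le_of_mul_le_mul_left ?_ h9
    linarith
  have hd : ∀ i, 0 < d i := by
    intro i
    refine lt_of_le_of_ne (hd0 i) fun h0 => hdet ?_
    have hTe : T (e i) = 0 := by
      refine ext_inner_right ℝ fun k => ?_
      have : ⟪T (e i), k⟫ = diagForm e d (e i) k := by rw [← hed]; rfl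
      rw [this, diagForm_apply, inner_zero_left, Finset.sum_eq_zero]
      intro j _
      by_cases hj : j = i
      · rw [hj, ← h0, zero_mul]
      · rw [e.inner_eq_zero hj, zero_mul, mul_zero]
    by_contra hdet'
    have hinj : Function.Injective T := by
      have := (LinearMap.equivOfDetNeZero (T : 𝔼 →ₗ[ℝ] 𝔼) hdet').injective
      exact this
    have := hinj (hTe.trans (map_zero T).symm)
    exact one_ne_zero (α := ℝ) (by rw [← e.norm_eq_one i, this, norm_zero])
  refine ⟨diagForm e d⁻¹, diagForm_comm _ _, fun ε hε => ?_⟩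
  have hconv : ConvexOn ℝ Ω F := hF.convexOn fun t => by positivity
  have hup := eventually_le_of_le_legendre hΩ hconv hD hx hy e hd
    (fun ε hε => (taylor ε hε).mono fun k hk => by
      have := (abs_le.mp hk).1
      linarith) hε
  have hlo := eventually_le_of_legendre_le hΩ hD hx hy e hd
    (show 0 ≤ ε / (‖diagMap e d⁻¹‖ ^ 2 + 1) by positivity)
    ((taylor (ε / (‖diagMap e d⁻¹‖ ^ 2 + 1)) (by positivity)).mono fun k hk => by
      have := (abs_le.mp hk).2
      linarith)
  filter_upwards [hup, hlo] with h h1 h2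
  have h3 : ε / (‖diagMap e d⁻¹‖ ^ 2 + 1) * ‖diagMap e d⁻¹‖ ^ 2 ≤ ε := by
    rw [div_mul_eq_mul_div, div_le_iff₀ (by positivity)]
    nlinarith
  have h4 := mul_le_mul_of_nonneg_right h3 (sq_nonneg ‖h‖)
  rw [abs_le]
  constructor <;> linarith

theorem ConvexOn.strongConvexOn_add_sq {Ω : Set 𝔼} {u : 𝔼 → ℝ} (hu : ConvexOn ℝ Ω u) {a : ℝ}
    (ha : 0 ≤ a) (m : ℝ) : StrongConvexOn Ω m fun x => a * u x + m / 2 * ‖x‖ ^ 2 := by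
  rw [strongConvexOn_iff_convex]
  simpa using hu.smul ha

/-- The quadratic gain in `StrongConvexOn.add_sq_le` is exactly the excess of m‖z‖²/2 over its
linearization at x. -/
theorem mem_subdifferential_of_add_sq {Ω : Set 𝔼} {u : 𝔼 → ℝ} (hu : ConvexOn ℝ Ω u) {a m : ℝ}
    (ha : 0 < a) {x y : 𝔼} (hx : x ∈ Ω)
    (hy : y ∈ subdifferential Ω (fun x => a * u x + m / 2 * ‖x‖ ^ 2) x) :
    a⁻¹ • (y - m • x) ∈ subdifferential Ω u x := by
  intro z hz
  have h := (hu.strongConvexOn_add_sq ha.le m).add_sq_le hx hy hz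
  have h1 : ‖z‖ ^ 2 = ‖x‖ ^ 2 + 2 * ⟪x, z - x⟫ + ‖z - x‖ ^ 2 := by
    rw [← norm_add_sq_real, add_sub_cancel]
  rw [h1] at h
  rw [inner_smul_left, inner_sub_left, inner_smul_left]
  simp only [conj_trivial]
  refine le_of_mul_le_mul_left ?_ ha
  rw [mul_add, ← mul_assoc a a⁻¹, mul_inv_cancel₀ ha.ne', one_mul]
  linarith

/-- **Alexandrov's theorem**: a convex function has a second-order expansion almost everywhere. -/
theorem ConvexOn.ae_exists_second_order {Ω : Set 𝔼} {u : 𝔼 → ℝ} (hu : ConvexOn ℝ Ω u)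
    (hΩ : IsOpen Ω) : ∀ᵐ x, x ∈ Ω → ∃ p ∈ subdifferential Ω u x, ∃ b : 𝔼 →L[ℝ] 𝔼 →L[ℝ] ℝ,
      (∀ h k, b h k = b k h) ∧ ∀ ε > 0, ∀ᶠ h in 𝓝 (0 : 𝔼),
        |u (x + h) - u x - ⟪p, h⟫ - b h h / 2| ≤ ε * ‖h‖ ^ 2 := by
  have hF := hu.strongConvexOn_add_sq zero_le_one 1
  filter_upwards [hF.ae_hasFDerivAt_gradient_legendre one_pos hΩ] with x hx hxΩ
  obtain ⟨y, hy, T, hT, hdet⟩ := hx hxΩ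
  obtain ⟨b, hb, hexp⟩ := hF.exists_second_order one_pos hΩ hxΩ hy hT hdet
  have hp := mem_subdifferential_of_add_sq hu one_pos hxΩ hy
  rw [inv_one, one_smul, one_smul] at hp
  refine ⟨y - x, hp, b - innerForm n, fun h k => ?_, fun ε hε => ?_⟩
  · simp [hb h k, real_inner_comm h k]
  · filter_upwards [hexp ε hε] with h hh
    refine le_of_eq_of_le (congrArg _ ?_) hh
    rw [norm_add_sq_real, inner_sub_left]
    simp only [sub_apply, innerForm_apply,
      real_inner_self_eq_norm_sq]
    ring

/-! ### Mollification of almost everywhere subsolutions -/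

/-- Fatou's lemma for real integrals. -/
theorem integral_le_of_tendsto_of_nonneg {α : Type*} [MeasurableSpace α] {μ : Measure α}
    {f : ℕ → α → ℝ} {h : α → ℝ} {I : ℝ} (hf0 : ∀ k z, 0 ≤ f k z)
    (hfi : ∀ k, Integrable (f k) μ) (hh : Integrable h μ)
    (hlim : ∀ᵐ z ∂μ, ∃ l, Tendsto (fun k => f k z) atTop (𝓝 l) ∧ h z ≤ l)
    (hI : Tendsto (fun k => ∫ z, f k z ∂μ) atTop (𝓝 I)) : ∫ z, h z ∂μ ≤ I := by
  have hI0 : 0 ≤ I := ge_of_tendsto' hI fun k => integral_nonneg (hf0 k)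
  have h1 : ∫⁻ z, ENNReal.ofReal (h z) ∂μ ≤ ENNReal.ofReal I := by
    calc ∫⁻ z, ENNReal.ofReal (h z) ∂μ
        ≤ ∫⁻ z, liminf (fun k => ENNReal.ofReal (f k z)) atTop ∂μ := by
          refine lintegral_mono_ae ?_
          filter_upwards [hlim] with z ⟨l, hl, hle⟩
          rw [(ENNReal.tendsto_ofReal hl).liminf_eq]
          exact ENNReal.ofReal_le_ofReal hle
      _ ≤ liminf (fun k => ∫⁻ z, ENNReal.ofReal (f k z) ∂μ) atTop :=
          lintegral_liminf_le' fun k => (hfi k).aemeasurable.ennreal_ofReal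
      _ = liminf (fun k => ENNReal.ofReal (∫ z, f k z ∂μ)) atTop := by
          simp_rw [ofReal_integral_eq_lintegral_ofReal (hfi _) (ae_of_all _ (hf0 _))]
      _ = ENNReal.ofReal I := (ENNReal.tendsto_ofReal hI).liminf_eq
  -- `h` may be negative; `ENNReal.ofReal` sees only its positive part, which suffices as an upper
  -- bound.
  calc ∫ z, h z ∂μ ≤ ∫ z, max (h z) 0 ∂μ :=
        integral_mono hh hh.pos_part fun z => le_max_left _ _
    _ = (∫⁻ z, ENNReal.ofReal (max (h z) 0) ∂μ).toReal :=
        integral_eq_lintegral_of_nonneg_ae (ae_of_all _ fun z => le_max_right _ _)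
          hh.pos_part.aestronglyMeasurable
    _ = (∫⁻ z, ENNReal.ofReal (h z) ∂μ).toReal := by simp [ENNReal.ofReal_max]
    _ ≤ (ENNReal.ofReal I).toReal := ENNReal.toReal_mono ENNReal.ofReal_ne_top h1
    _ = I := ENNReal.toReal_ofReal hI0

/-- The symmetric second difference quotient of `f` at `x` in direction `e`. -/
def secondDiff (f : 𝔼 → ℝ) (x e : 𝔼) (t : ℝ) : ℝ :=
  (f (x + t • e) + f (x - t • e) - 2 * f x) / t ^ 2

theorem tendsto_secondDiff {f : 𝔼 → ℝ} {x : 𝔼} {l : 𝔼 →L[ℝ] ℝ} {b : 𝔼 →L[ℝ] 𝔼 →L[ℝ] ℝ}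
    (hf : ∀ ε > 0, ∀ᶠ h in 𝓝 (0 : 𝔼), |f (x + h) - f x - l h - b h h / 2| ≤ ε * ‖h‖ ^ 2)
    (e : 𝔼) : Tendsto (secondDiff f x e) (𝓝[≠] 0) (𝓝 (b e e)) := by
  rw [Metric.tendsto_nhds]
  intro ε hε
  set η := ε / (2 * (‖e‖ ^ 2 + 1))
  have hη : 0 < η := by positivity
  have hlim : ∀ s : ℝ, Tendsto (fun t : ℝ => (s * t) • e) (𝓝[≠] 0) (𝓝 0) := by
    intro s
    have hc : Continuous fun t : ℝ => (s * t) • e := by fun_prop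
    have := hc.tendsto 0
    rw [mul_zero, zero_smul] at this
    exact this.mono_left nhdsWithin_le_nhds
  filter_upwards [(hlim 1).eventually (hf η hη), (hlim (-1)).eventually (hf η hη),
    self_mem_nhdsWithin] with t h1 h2 h3
  have ht : 0 < t ^ 2 := by
    have : t ≠ 0 := h3
    positivity
  have hq : ∀ s : ℝ, s ^ 2 = 1 → b ((s * t) • e) ((s * t) • e) = t ^ 2 * b e e := by
    intro s hs
    rw [map_smul, map_smul, smul_apply]
    simp only [smul_eq_mul]
    linear_combination t ^ 2 * b e e * hs
  have hn : ∀ s : ℝ, s ^ 2 = 1 → ‖(s * t) • e‖ ^ 2 = t ^ 2 * ‖e‖ ^ 2 := by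
    intro s hs
    rw [norm_smul, mul_pow, Real.norm_eq_abs, sq_abs]
    linear_combination t ^ 2 * ‖e‖ ^ 2 * hs
  rw [hq 1 (by norm_num), hn 1 (by norm_num), map_smul, one_mul, abs_le] at h1
  rw [hq (-1) (by norm_num), hn (-1) (by norm_num), map_smul, neg_one_mul, abs_le, neg_smul,
    ← sub_eq_add_neg] at h2
  simp only [smul_eq_mul] at h1 h2
  have hηe : 2 * η * ‖e‖ ^ 2 < ε := by
    have : 2 * η * (‖e‖ ^ 2 + 1) = ε := by simp only [η]; field_simp
    nlinarith
  have hmul := mul_lt_mul_of_pos_left hηe ht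
  rw [Real.dist_eq, secondDiff, abs_lt]
  constructor
  · rw [lt_sub_iff_add_lt, lt_div_iff₀ ht]
    linarith
  · rw [sub_lt_iff_lt_add, div_lt_iff₀ ht]
    linarith

theorem ConvexOn.secondDiff_nonneg {Ω : Set 𝔼} {f : 𝔼 → ℝ} (hf : ConvexOn ℝ Ω f) {x e : 𝔼} {t : ℝ}
    (h1 : x + t • e ∈ Ω) (h2 : x - t • e ∈ Ω) : 0 ≤ secondDiff f x e t := by
  have h := hf.2 h1 h2 (by norm_num : (0 : ℝ) ≤ 1 / 2) (by norm_num : (0 : ℝ) ≤ 1 / 2) (by norm_num)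
  have hx : (1 / 2 : ℝ) • (x + t • e) + (1 / 2 : ℝ) • (x - t • e) = x := by module
  rw [hx] at h
  simp only [smul_eq_mul] at h
  exact div_nonneg (by linarith) (sq_nonneg t)

/-- Convolution with the normalized bump function `φ`. -/
def mollify (φ : ContDiffBump (0 : 𝔼)) (g : 𝔼 → ℝ) (x : 𝔼) : ℝ :=
  ∫ z, φ.normed volume z * g (x - z)

theorem mollify_eq_convolution (φ : ContDiffBump (0 : 𝔼)) (g : 𝔼 → ℝ) :
    mollify φ g = convolution (φ.normed volume) g (ContinuousLinearMap.lsmul ℝ ℝ) volume := rfl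

theorem contDiff_mollify (φ : ContDiffBump (0 : 𝔼)) {g : 𝔼 → ℝ} (hg : Continuous g) :
    ContDiff ℝ 2 (mollify φ g) := by
  rw [mollify_eq_convolution]
  exact φ.hasCompactSupport_normed.contDiff_convolution_left _ φ.contDiff_normed
    hg.locallyIntegrable

theorem abs_mollify_sub_le (φ : ContDiffBump (0 : 𝔼)) {g : 𝔼 → ℝ} (hg : Continuous g) {x : 𝔼}
    {δ : ℝ} (h : ∀ y ∈ ball x φ.rOut, dist (g y) (g x) ≤ δ) : |mollify φ g x - g x| ≤ δ := by
  rw [mollify_eq_convolution]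
  exact φ.dist_normed_convolution_le hg.aestronglyMeasurable h

theorem integrable_bump_mul (φ : ContDiffBump (0 : 𝔼)) {f : 𝔼 → ℝ} (hf : Continuous f) :
    Integrable fun z => φ.normed volume z * f z :=
  (φ.continuous_normed.mul hf).integrable_of_hasCompactSupport φ.hasCompactSupport_normed.mul_right

theorem bump_eq_zero_of_notMem (φ : ContDiffBump (0 : 𝔼)) {z : 𝔼} (hz : z ∉ ball 0 φ.rOut) :
    φ.normed volume z = 0 := by
  rw [← φ.support_normed_eq (μ := volume)] at hz
  exact Function.notMem_support.mp hz

theorem ConvexOn.mollify {φ : ContDiffBump (0 : 𝔼)} {g : 𝔼 → ℝ} {Ω K : Set 𝔼} (hg : ConvexOn ℝ Ω g)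
    (hgc : Continuous g) (hK : Convex ℝ K) (hKΩ : ∀ x ∈ K, ∀ z ∈ ball (0 : 𝔼) φ.rOut, x - z ∈ Ω) :
    ConvexOn ℝ K (mollify φ g) := by
  refine ⟨hK, fun x hx y hy a b ha hb hab => ?_⟩
  simp only [_root_.mollify, smul_eq_mul]
  rw [← integral_const_mul, ← integral_const_mul, ← integral_add
    ((integrable_bump_mul φ (by fun_prop)).const_mul a)
    ((integrable_bump_mul φ (by fun_prop)).const_mul b)]
  refine integral_mono (integrable_bump_mul φ (by fun_prop))
    (((integrable_bump_mul φ (by fun_prop)).const_mul a).add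
    ((integrable_bump_mul φ (by fun_prop)).const_mul b)) fun z => ?_
  by_cases hz : z ∈ ball (0 : 𝔼) φ.rOut
  · have h1 := hg.2 (hKΩ x hx z hz) (hKΩ y hy z hz) ha hb hab
    have h2 : a • (x - z) + b • (y - z) = a • x + b • y - z := by
      rw [smul_sub, smul_sub, sub_add_sub_comm, ← add_smul, hab, one_smul]
    rw [h2] at h1
    have h3 := mul_le_mul_of_nonneg_left h1 (φ.nonneg_normed (μ := volume) z)
    simp only [smul_eq_mul] at h3 ⊢
    linarith
  · simp [bump_eq_zero_of_notMem φ hz]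

theorem secondDiff_mollify (φ : ContDiffBump (0 : 𝔼)) {g : 𝔼 → ℝ} (hg : Continuous g)
    (x e : 𝔼) (t : ℝ) : secondDiff (mollify φ g) x e t =
      ∫ z, φ.normed volume z * secondDiff g (x - z) e t := by
  have hi : ∀ w, Integrable fun z => φ.normed volume z * g (w - z) := fun w =>
    integrable_bump_mul φ (by fun_prop)
  have hi2 : Integrable fun z => φ.normed volume z * g (x + t • e - z) +
      φ.normed volume z * g (x - t • e - z) := (hi _).add (hi _)
  simp only [secondDiff, mollify]
  rw [← integral_const_mul, ← integral_add (hi _) (hi _),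
    ← integral_sub hi2 ((hi _).const_mul 2), ← integral_div]
  refine integral_congr_ae (ae_of_all _ fun z => ?_)
  have h1 : x + t • e - z = x - z + t • e := by abel
  have h2 : x - t • e - z = x - z - t • e := by abel
  simp only [h1, h2]
  ring

theorem continuous_secondDiff {g : 𝔼 → ℝ} (hg : Continuous g) (x e : 𝔼) (t : ℝ) :
    Continuous fun z => secondDiff g (x - z) e t := by
  unfold secondDiff
  fun_prop

theorem nonneg_of_second_order {f : 𝔼 → ℝ} {x : 𝔼} {l : 𝔼 →L[ℝ] ℝ} {b : 𝔼 →L[ℝ] 𝔼 →L[ℝ] ℝ}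
    {Ω : Set 𝔼} (hΩ : IsOpen Ω) (hx : x ∈ Ω) (hconv : ConvexOn ℝ Ω f)
    (hf : ∀ ε > 0, ∀ᶠ h in 𝓝 (0 : 𝔼), |f (x + h) - f x - l h - b h h / 2| ≤ ε * ‖h‖ ^ 2)
    (e : 𝔼) : 0 ≤ b e e := by
  refine ge_of_tendsto (tendsto_secondDiff hf e) ?_
  have hlim : ∀ s : ℝ, Tendsto (fun t : ℝ => x + (s * t) • e) (𝓝[≠] 0) (𝓝 x) := by
    intro s
    have hc : Continuous fun t : ℝ => x + (s * t) • e := by fun_prop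
    have := hc.tendsto 0
    rw [mul_zero, zero_smul, add_zero] at this
    exact this.mono_left nhdsWithin_le_nhds
  filter_upwards [(hlim 1).eventually (hΩ.mem_nhds hx), (hlim (-1)).eventually (hΩ.mem_nhds hx)]
    with t h1 h2
  rw [one_mul] at h1
  rw [neg_one_mul, neg_smul, ← sub_eq_add_neg] at h2
  exact hconv.secondDiff_nonneg h1 h2

/-- Mollification preserves a lower bound of the phase that is affine in the gradient: the phase
is concave on convex functions, and the singular part of the Hessian is nonnegative. -/
theorem le_formPhase_mollify {φ : ContDiffBump (0 : 𝔼)} {g : 𝔼 → ℝ} {Ω : Set 𝔼} (hΩ : IsOpen Ω)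
    (hg : ConvexOn ℝ Ω g) (hgc : Continuous g) {L : ℝ} {ξ : 𝔼}
    (hae : ∀ᵐ y, y ∈ Ω → ∃ p ∈ subdifferential Ω g y, ∃ b : 𝔼 →L[ℝ] 𝔼 →L[ℝ] ℝ,
      (∀ h k, b h k = b k h) ∧ (∀ ε > 0, ∀ᶠ h in 𝓝 (0 : 𝔼),
        |g (y + h) - g y - ⟪p, h⟫ - b h h / 2| ≤ ε * ‖h‖ ^ 2) ∧ L + ⟪ξ, p⟫ ≤ formPhase b)
    {x : 𝔼} {r : ℝ} (hr : 0 < r) (hx : ball x (r + φ.rOut) ⊆ Ω) :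
    L + fderiv ℝ (mollify φ g) x ξ ≤ formPhase (fderiv ℝ (fderiv ℝ (mollify φ g)) x) := by
  set v := mollify φ g
  have hv : ContDiffAt ℝ 2 v x := (contDiff_mollify φ hgc).contDiffAt
  have hin : ∀ z ∈ ball (0 : 𝔼) φ.rOut, ∀ w ∈ ball (0 : 𝔼) r, x - z + w ∈ Ω := by
    intro z hz w hw
    refine hx ?_
    rw [mem_ball_zero_iff] at hz hw
    rw [mem_ball, dist_eq_norm]
    calc ‖x - z + w - x‖ = ‖w - z‖ := by congr 1; abel
      _ ≤ ‖w‖ + ‖z‖ := norm_sub_le _ _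
      _ < _ := by linarith
  have hin0 : ∀ z ∈ ball (0 : 𝔼) φ.rOut, x - z ∈ Ω := fun z hz => by
    simpa using hin z hz 0 (mem_ball_self hr)
  have hvconv : ConvexOn ℝ (ball x r) v := hg.mollify hgc (convex_ball x r) fun x' hx' z hz => by
    have := hin z hz (x' - x) (by rwa [mem_ball_zero_iff, ← dist_eq_norm])
    rwa [show x - z + (x' - x) = x' - z by abel] at this
  have hvexp : ∀ ε > 0, ∀ᶠ h in 𝓝 (0 : 𝔼), |v (x + h) - v x - fderiv ℝ v x h -
      fderiv ℝ (fderiv ℝ v) x h h / 2| ≤ ε * ‖h‖ ^ 2 := fun ε hε =>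
    hv.eventually_abs_taylor_two_le hε
  have hBpos := nonneg_of_second_order isOpen_ball (mem_ball_self hr) hvconv hvexp
  obtain ⟨e, μ, hB⟩ := exists_eq_diagForm hv.fderiv_fderiv_symm
  rw [hB] at hvexp hBpos
  have hμ : ∀ j, 0 ≤ μ j := fun j => diagForm_basis e μ j ▸ hBpos (e j)
  have hw : ∀ j, 0 ≤ (1 + μ j ^ 2)⁻¹ := fun j => by positivity
  rw [hB, formPhase_diagForm]
  set C := ∑ j, (Real.arctan (μ j) - (1 + μ j ^ 2)⁻¹ * μ j)
  -- The linearization of the phase at the Hessian of `v`, applied to second differences of `g`.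
  -- Averaging against the bump turns it into the same expression for `v`.
  set S : ℝ → 𝔼 → ℝ := fun t z => ∑ j, (1 + μ j ^ 2)⁻¹ * secondDiff g (x - z) (e j) t
  have hSc : ∀ t, Continuous (S t) := fun t =>
    continuous_finsetSum _ fun j _ => (continuous_secondDiff hgc x (e j) t).const_mul _
  -- the step of the difference quotients
  set τ : ℕ → ℝ := fun k => r / 2 * (1 / ((k : ℝ) + 1))
  have hτpos : ∀ k, 0 < τ k := fun k => by positivity
  have hτlt : ∀ k, τ k < r := fun k => by
    have : 1 / ((k : ℝ) + 1) ≤ 1 := by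
      rw [div_le_one (by positivity)]
      have : (0 : ℝ) ≤ k := k.cast_nonneg
      linarith
    calc τ k ≤ r / 2 * 1 := mul_le_mul_of_nonneg_left this (by positivity)
      _ < r := by linarith
  have hτ0 : Tendsto τ atTop (𝓝[≠] 0) := by
    refine tendsto_nhdsWithin_iff.mpr ⟨?_, Eventually.of_forall fun k => (hτpos k).ne'⟩
    have := (tendsto_one_div_add_atTop_nhds_zero_nat (𝕜 := ℝ)).const_mul (r / 2)
    rwa [mul_zero] at this
  have hS0 : ∀ k z, 0 ≤ φ.normed volume z * S (τ k) z := by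
    intro k z
    by_cases hz : z ∈ ball (0 : 𝔼) φ.rOut
    · refine mul_nonneg (φ.nonneg_normed z) (Finset.sum_nonneg fun j _ => mul_nonneg (hw j) ?_)
      have hn : ‖τ k • e j‖ < r := by
        rw [norm_smul, e.norm_eq_one, mul_one, Real.norm_of_nonneg (hτpos k).le]
        exact hτlt k
      refine hg.secondDiff_nonneg (hin z hz _ (mem_ball_zero_iff.mpr hn)) ?_
      rw [sub_eq_add_neg]
      exact hin z hz _ (mem_ball_zero_iff.mpr (by rwa [norm_neg]))
    · rw [bump_eq_zero_of_notMem φ hz, zero_mul]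
  have hSlim : Tendsto (fun k => ∫ z, φ.normed volume z * S (τ k) z) atTop
      (𝓝 (∑ j, (1 + μ j ^ 2)⁻¹ * μ j)) := by
    have h1 : ∀ k, ∫ z, φ.normed volume z * S (τ k) z =
        ∑ j, (1 + μ j ^ 2)⁻¹ * secondDiff v x (e j) (τ k) := by
      intro k
      simp only [S, Finset.mul_sum]
      rw [integral_finsetSum]
      · refine Finset.sum_congr rfl fun j _ => ?_
        rw [secondDiff_mollify φ hgc, ← integral_const_mul]
        refine integral_congr_ae (ae_of_all _ fun z => ?_)
        simp only
        ring
      · intro j _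
        exact integrable_bump_mul φ ((continuous_secondDiff hgc x (e j) _).const_mul _)
    simp only [h1]
    refine tendsto_finsetSum _ fun j _ => Tendsto.const_mul _ ?_
    have := (tendsto_secondDiff hvexp (e j)).comp hτ0
    rwa [diagForm_basis] at this
  -- the integrated inequality, with the gradient replaced by a backward difference quotient
  have key : ∀ t : ℝ, 0 < t → t * ‖ξ‖ < r →
      L - C + (v x - v (x - t • ξ)) / t ≤ ∑ j, (1 + μ j ^ 2)⁻¹ * μ j := by
    intro t ht htr
    have hHc : Continuous fun z => L - C + (g (x - z) - g (x - z - t • ξ)) / t := by fun_prop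
    -- Fatou discards the singular part of the Hessian of `g`: convexity makes the second
    -- differences nonnegative on the support of the bump, so the loss has the favourable sign.
    have hint := integral_le_of_tendsto_of_nonneg (h := fun z =>
      φ.normed volume z * (L - C + (g (x - z) - g (x - z - t • ξ)) / t)) hS0
      (fun k => integrable_bump_mul φ (hSc _)) (integrable_bump_mul φ hHc) ?_ hSlim
    · refine le_of_eq_of_le ?_ hint
      have h1 : (fun z => φ.normed volume z * (L - C + (g (x - z) - g (x - z - t • ξ)) / t)) =
          fun z => φ.normed volume z * (L - C) + (φ.normed volume z * g (x - z) -
            φ.normed volume z * g (x - t • ξ - z)) / t := by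
        funext z
        rw [show x - t • ξ - z = x - z - t • ξ by abel]
        ring
      have hi : ∀ w, Integrable fun z => φ.normed volume z * g (w - z) := fun w =>
        integrable_bump_mul φ (by fun_prop)
      have hi2 : Integrable fun z => (φ.normed volume z * g (x - z) -
          φ.normed volume z * g (x - t • ξ - z)) / t := ((hi _).sub (hi _)).div_const t
      rw [h1, integral_add (integrable_bump_mul φ continuous_const) hi2, integral_div,
        integral_sub (hi _) (hi _), integral_mul_const, φ.integral_normed, one_mul]
      rfl
    · have hae' : ∀ᵐ z, x - z ∈ Ω → ∃ p ∈ subdifferential Ω g (x - z),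
          ∃ b : 𝔼 →L[ℝ] 𝔼 →L[ℝ] ℝ, (∀ h k, b h k = b k h) ∧ (∀ ε > 0, ∀ᶠ h in 𝓝 (0 : 𝔼),
            |g (x - z + h) - g (x - z) - ⟪p, h⟫ - b h h / 2| ≤ ε * ‖h‖ ^ 2) ∧
            L + ⟪ξ, p⟫ ≤ formPhase b :=
        (Measure.measurePreserving_sub_left volume x).quasiMeasurePreserving.ae hae
      filter_upwards [hae'] with z hz
      by_cases hzb : z ∈ ball (0 : 𝔼) φ.rOut
      · obtain ⟨p, hp, b, hb, hexp, hle⟩ := hz (hin0 z hzb)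
        have hexp' : ∀ ε > 0, ∀ᶠ h in 𝓝 (0 : 𝔼),
            |g (x - z + h) - g (x - z) - innerSL ℝ p h - b h h / 2| ≤ ε * ‖h‖ ^ 2 := hexp
        have hb0 := nonneg_of_second_order hΩ (hin0 z hzb) hg hexp'
        refine ⟨φ.normed volume z * ∑ j, (1 + μ j ^ 2)⁻¹ * b (e j) (e j), ?_, ?_⟩
        · refine Tendsto.const_mul _ (tendsto_finsetSum _ fun j _ => Tendsto.const_mul _ ?_)
          exact (tendsto_secondDiff hexp' (e j)).comp hτ0
        · refine mul_le_mul_of_nonneg_left ?_ (φ.nonneg_normed z)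
          have h1 := formPhase_le_linearization hb hb0 e hμ
          have h2 : ∑ j, (Real.arctan (μ j) + (1 + μ j ^ 2)⁻¹ * (b (e j) (e j) - μ j)) =
              C + ∑ j, (1 + μ j ^ 2)⁻¹ * b (e j) (e j) := by
            rw [← Finset.sum_add_distrib]
            exact Finset.sum_congr rfl fun j _ => by ring
          have h3 : x - z - t • ξ ∈ Ω := by
            rw [sub_eq_add_neg]
            refine hin z hzb _ ?_
            rwa [mem_ball_zero_iff, norm_neg, norm_smul, Real.norm_of_nonneg ht.le]
          have h4 := hp _ h3
          rw [sub_sub_cancel_left, inner_neg_right, inner_smul_right] at h4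
          -- A backward quotient lies below the subgradient slope, which is the direction needed;
          -- `g` is never differentiated under the integral.
          have h5 : (g (x - z) - g (x - z - t • ξ)) / t ≤ ⟪ξ, p⟫ := by
            rw [div_le_iff₀ ht, real_inner_comm]
            linarith
          linarith
      · simp only [bump_eq_zero_of_notMem φ hzb, zero_mul]
        exact ⟨0, tendsto_const_nhds, le_rfl⟩
  have hlim : Tendsto (fun t : ℝ => L - C + (v x - v (x - t • ξ)) / t) (𝓝[>] 0)
      (𝓝 (L - C + fderiv ℝ v x ξ)) := by
    refine tendsto_const_nhds.add ?_
    have h1 : HasFDerivAt v (fderiv ℝ v x) x := (hv.differentiableAt (by simp)).hasFDerivAt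
    have h2 : HasDerivAt (fun t : ℝ => v (x - t • ξ)) (-(fderiv ℝ v x ξ)) 0 := by
      have h3 : HasDerivAt (fun t : ℝ => x - t • ξ) (-ξ) 0 := by
        simpa using ((hasDerivAt_id (0 : ℝ)).smul_const ξ).const_sub x
      have h4 : HasFDerivAt v (fderiv ℝ v x) (x - (0 : ℝ) • ξ) := by simpa using h1
      have := h4.comp_hasDerivAt (0 : ℝ) h3
      rwa [map_neg] at this
    have h5 := (hasDerivAt_iff_tendsto_slope.mp h2).neg
    rw [neg_neg] at h5
    refine (h5.mono_left (nhdsWithin_mono 0 fun t ht => ne_of_gt ht)).congr fun t => ?_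
    rw [slope_def_field]
    simp only [zero_smul, sub_zero]
    ring
  have hfin := le_of_tendsto hlim (b := ∑ j, (1 + μ j ^ 2)⁻¹ * μ j) (by
    have hpos : 0 < r / (‖ξ‖ + 1) := by positivity
    filter_upwards [Ioo_mem_nhdsGT hpos] with t ht
    refine key t ht.1 ?_
    have := (lt_div_iff₀ (by positivity)).mp ht.2
    nlinarith [ht.1])
  have hC : C = ∑ j, Real.arctan (μ j) - ∑ j, (1 + μ j ^ 2)⁻¹ * μ j := Finset.sum_sub_distrib _ _
  linarith

/-! ### Quadratic test functions and pointwise viscosity inequalities -/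

/-- The quadratic polynomial with prescribed gradient and Hessian at `x`. -/
def quadPoly (x p : 𝔼) (B : 𝔼 →L[ℝ] 𝔼 →L[ℝ] ℝ) (z : 𝔼) : ℝ :=
  ⟪p, z - x⟫ + B (z - x) (z - x) / 2

theorem hasFDerivAt_quadPoly (x p : 𝔼) {B : 𝔼 →L[ℝ] 𝔼 →L[ℝ] ℝ} (hB : ∀ h k, B h k = B k h)
    (z : 𝔼) : HasFDerivAt (quadPoly x p B) (innerSL ℝ p + B (z - x)) z := by
  have h0 : HasFDerivAt (fun z : 𝔼 => z - x) (ContinuousLinearMap.id ℝ 𝔼) z :=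
    (hasFDerivAt_id z).sub_const x
  have h1 : HasFDerivAt (fun z : 𝔼 => ⟪p, z - x⟫) (innerSL ℝ p) z := by
    have := (innerSL ℝ p).hasFDerivAt.comp z h0
    exact this
  have h2 := ((B.hasFDerivAt.comp z h0).clm_apply h0).const_mul (1 / 2 : ℝ)
  refine ((h1.add h2).congr_fderiv ?_).congr_of_eventuallyEq (Eventually.of_forall fun z => ?_)
  · ext v
    have := hB v (z - x)
    simp at this ⊢
    linarith
  · simp [quadPoly]
    ring

theorem fderiv_quadPoly (x p : 𝔼) {B : 𝔼 →L[ℝ] 𝔼 →L[ℝ] ℝ} (hB : ∀ h k, B h k = B k h) :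
    fderiv ℝ (quadPoly x p B) = fun z => innerSL ℝ p + B (z - x) :=
  funext fun z => (hasFDerivAt_quadPoly x p hB z).fderiv

theorem contDiff_quadPoly (x p : 𝔼) (B : 𝔼 →L[ℝ] 𝔼 →L[ℝ] ℝ) : ContDiff ℝ 2 (quadPoly x p B) := by
  unfold quadPoly
  have h0 : ContDiff ℝ 2 fun z : 𝔼 => z - x := contDiff_id.sub contDiff_const
  exact (contDiff_const.inner ℝ h0).add (((B.contDiff.comp h0).clm_apply h0).div_const 2)

theorem gradient_quadPoly (x p : 𝔼) {B : 𝔼 →L[ℝ] 𝔼 →L[ℝ] ℝ} (hB : ∀ h k, B h k = B k h) :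
    gradient (quadPoly x p B) x = p := by
  have h := hasFDerivAt_quadPoly x p hB x
  rw [sub_self, map_zero, add_zero] at h
  exact HasGradientAt.gradient h

theorem phase_hessian_quadPoly (x p : 𝔼) {B : 𝔼 →L[ℝ] 𝔼 →L[ℝ] ℝ} (hB : ∀ h k, B h k = B k h) :
    phase (hessian (quadPoly x p B) x) = formPhase B := by
  have h : fderiv ℝ (fderiv ℝ (quadPoly x p B)) x = B := by
    rw [fderiv_quadPoly x p hB]
    refine HasFDerivAt.fderiv ?_
    have h0 : HasFDerivAt (fun z : 𝔼 => z - x) (ContinuousLinearMap.id ℝ 𝔼) x :=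
      (hasFDerivAt_id x).sub_const x
    exact (B.hasFDerivAt.comp x h0).const_add _
  simp only [hessian, h, formPhase]

theorem eventually_nhds_of_add {x : 𝔼} {P : 𝔼 → Prop} (h : ∀ᶠ h in 𝓝 (0 : 𝔼), P (x + h)) :
    ∀ᶠ z in 𝓝 x, P z := by
  have hc : Tendsto (fun z : 𝔼 => z - x) (𝓝 x) (𝓝 0) := by
    have : Continuous fun z : 𝔼 => z - x := by fun_prop
    simpa using this.tendsto x
  filter_upwards [hc.eventually h] with z hz
  rwa [add_sub_cancel] at hz

section Viscosity

variable {Ω : Set (EuclideanSpace ℝ (Fin n))}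
  {f : EuclideanSpace ℝ (Fin n) → ℝ → EuclideanSpace ℝ (Fin n) → ℝ}
  {u : EuclideanSpace ℝ (Fin n) → ℝ}

theorem IsViscositySolution.formPhase_le (hu : IsViscositySolution Ω f u) {x p : 𝔼} (hx : x ∈ Ω)
    {B : 𝔼 →L[ℝ] 𝔼 →L[ℝ] ℝ} (hB : ∀ h k, B h k = B k h)
    (h : ∀ᶠ h in 𝓝 (0 : 𝔼), u x + ⟪p, h⟫ + B h h / 2 ≤ u (x + h)) :
    formPhase B ≤ f x (u x) p := by
  have := hu.supersolution x hx (quadPoly x p B) (contDiff_quadPoly x p B).contDiffAt ?_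
  · rwa [phase_hessian_quadPoly x p hB, gradient_quadPoly x p hB] at this
  · refine (eventually_nhds_of_add (h.mono fun h hh => ?_)).filter_mono nhdsWithin_le_nhds
    simp only [quadPoly, sub_self, add_sub_cancel_left, inner_zero_right, map_zero]
    linarith

theorem IsViscositySolution.le_formPhase (hu : IsViscositySolution Ω f u) {x p : 𝔼} (hx : x ∈ Ω)
    {B : 𝔼 →L[ℝ] 𝔼 →L[ℝ] ℝ} (hB : ∀ h k, B h k = B k h)
    (h : ∀ᶠ h in 𝓝 (0 : 𝔼), u (x + h) ≤ u x + ⟪p, h⟫ + B h h / 2) :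
    f x (u x) p ≤ formPhase B := by
  have := hu.subsolution x hx (quadPoly x p B) (contDiff_quadPoly x p B).contDiffAt ?_
  · rwa [phase_hessian_quadPoly x p hB, gradient_quadPoly x p hB] at this
  · refine (eventually_nhds_of_add (h.mono fun h hh => ?_)).filter_mono nhdsWithin_le_nhds
    simp only [quadPoly, sub_self, add_sub_cancel_left, inner_zero_right, map_zero]
    linarith

/-- The expansion need not touch from above until its Hessian is raised by a small multiple of the
identity, which costs the phase at most n times that multiple. -/
theorem IsViscositySolution.le_formPhase_of_second_order (hu : IsViscositySolution Ω f u)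
    {x p : 𝔼} (hx : x ∈ Ω) {b : 𝔼 →L[ℝ] 𝔼 →L[ℝ] ℝ} (hb : ∀ h k, b h k = b k h)
    (h : ∀ ε > 0, ∀ᶠ h in 𝓝 (0 : 𝔼), |u (x + h) - u x - ⟪p, h⟫ - b h h / 2| ≤ ε * ‖h‖ ^ 2) :
    f x (u x) p ≤ formPhase b := by
  refine le_of_forall_pos_le_add fun ε hε => ?_
  set η := ε / (n + 1)
  have hη : 0 < η := by positivity
  have hsymm : ∀ h k, (b + η • innerForm n) h k = (b + η • innerForm n) k h := fun h k => by
    simp [hb h k, real_inner_comm h k]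
  have h1 := hu.le_formPhase (p := p) hx hsymm ((h (η / 2) (by positivity)).mono fun h hh => by
    have := (abs_le.mp hh).2
    simp only [add_apply, smul_apply, innerForm_apply, smul_eq_mul, real_inner_self_eq_norm_sq]
    linarith)
  have h2 := formPhase_le_of_le_add hsymm hb hη.le fun x => by
    simp
  have h3 : n * η ≤ ε := by
    have : (n + 1) * η = ε := by simp only [η]; field_simp
    linarith
  linarith

end Viscosity

/-- Mollification of a convex function that is a pointwise almost everywhere subsolution, with a
right-hand side affine in the gradient. -/
theorem ConvexOn.exists_contDiff_approx {Ω : Set 𝔼} {u : 𝔼 → ℝ} (hΩ : IsOpen Ω)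
    (hu : ConvexOn ℝ Ω u) {x₀ ξ : 𝔼} {r L : ℝ} (hr : 0 < r) (hball : closedBall x₀ (3 * r) ⊆ Ω)
    (hae : ∀ᵐ y, y ∈ ball x₀ (3 * r) → ∃ p ∈ subdifferential Ω u y, ∃ b : 𝔼 →L[ℝ] 𝔼 →L[ℝ] ℝ,
      (∀ h k, b h k = b k h) ∧ (∀ ε > 0, ∀ᶠ h in 𝓝 (0 : 𝔼),
        |u (y + h) - u y - ⟪p, h⟫ - b h h / 2| ≤ ε * ‖h‖ ^ 2) ∧ L + ⟪ξ, p⟫ ≤ formPhase b)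
    {σ : ℝ} (hσ : 0 < σ) :
    ∃ v : 𝔼 → ℝ, ContDiff ℝ 2 v ∧ ConvexOn ℝ (closedBall x₀ r) v ∧
      (∀ x ∈ closedBall x₀ r, |v x - u x| ≤ σ) ∧
      ∀ x ∈ closedBall x₀ r, L + fderiv ℝ v x ξ ≤ formPhase (fderiv ℝ (fderiv ℝ v) x) := by
  have hcont : ContinuousOn u (closedBall x₀ (3 * r)) := (hu.continuousOn hΩ).mono hball
  -- Tietze extension: mollification is defined for globally continuous functions.
  obtain ⟨g, hg⟩ := ContinuousMap.exists_restrict_eq (isClosed_closedBall (x := x₀) (ε := 3 * r))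
    ⟨_, hcont.domRestrict⟩
  have hgu : ∀ x ∈ closedBall x₀ (3 * r), g x = u x := fun x hx =>
    congrArg (fun f : C(closedBall x₀ (3 * r), ℝ) => f ⟨x, hx⟩) hg
  have hgu' : ∀ x ∈ ball x₀ (3 * r), g x = u x := fun x hx => hgu x (ball_subset_closedBall hx)
  have hgconv : ConvexOn ℝ (ball x₀ (3 * r)) g :=
    (hu.subset (ball_subset_closedBall.trans hball) (convex_ball _ _)).congr
      fun x hx => (hgu' x hx).symm
  have hunif := (isCompact_closedBall x₀ (3 * r)).uniformContinuousOn_of_continuous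
    g.continuous.continuousOn
  obtain ⟨δ, hδ, hunif⟩ := Metric.uniformContinuousOn_iff.mp hunif σ hσ
  -- The bound by `r` keeps balls of radius r + ρ around points of the `r`-ball inside the 3r-ball;
  -- the bound by `δ` gives σ-closeness.
  set ρ := min r δ
  have hρ : 0 < ρ := lt_min hr hδ
  set φ : ContDiffBump (0 : 𝔼) := ⟨ρ / 2, ρ, half_pos hρ, half_lt_self hρ⟩
  have hφ : φ.rOut = ρ := rfl
  have hρr : ρ ≤ r := min_le_left _ _
  have hin : ∀ x ∈ closedBall x₀ r, ball x (r + ρ) ⊆ ball x₀ (3 * r) := by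
    intro x hx
    refine ball_subset_ball' ?_
    have := mem_closedBall.mp hx
    linarith
  refine ⟨_root_.mollify φ g, contDiff_mollify φ g.continuous, ?_, fun x hx => ?_, fun x hx => ?_⟩
  · refine hgconv.mollify g.continuous (convex_closedBall _ _) fun x hx z hz => hin x hx ?_
    rw [mem_ball_zero_iff, hφ] at hz
    rw [mem_ball, dist_eq_norm, sub_sub_cancel_left, norm_neg]
    linarith
  · have hx3 : x ∈ closedBall x₀ (3 * r) := closedBall_subset_closedBall (by linarith) hx
    rw [← hgu x hx3]
    refine abs_mollify_sub_le φ g.continuous fun y hy => ?_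
    rw [hφ] at hy
    have hy3 := hin x hx (ball_subset_ball (by linarith) hy)
    exact (hunif y (ball_subset_closedBall hy3) x hx3
      ((mem_ball.mp hy).trans_le (min_le_right _ _))).le
  · refine le_formPhase_mollify isOpen_ball hgconv g.continuous ?_ hr (hφ ▸ hin x hx)
    filter_upwards [hae] with y hy hyb
    obtain ⟨p, hp, b, hb, hexp, hle⟩ := hy hyb
    refine ⟨p, fun z hz => ?_, b, hb, fun ε hε => ?_, hle⟩
    · rw [hgu' y hyb, hgu' z hz]
      exact hp z (hball (ball_subset_closedBall hz))
    · filter_upwards [hexp ε hε, (tendsto_add_nhds_zero y).eventually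
        (isOpen_ball.mem_nhds hyb)] with h h1 h2
      rwa [hgu' y hyb, hgu' _ h2]

/-! ### Legendre transforms over compact sets and stability of touching -/

section Compact

variable {K : Set (EuclideanSpace ℝ (Fin n))} {G : EuclideanSpace ℝ (Fin n) → ℝ}

/-- Over a compact set the transform is finite and attained at every slope, even without convexity;
this is why approximations are transformed over closed balls. -/
theorem IsCompact.subgradientImage_eq_univ (hK : IsCompact K) (hne : K.Nonempty)
    (hG : ContinuousOn G K) : subgradientImage K G = univ :=
  eq_univ_of_forall fun y => by
    obtain ⟨x, hx, hy⟩ := hK.exists_mem_subdifferential hne hG y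
    exact mem_subgradientImage.mpr ⟨x, hx, hy⟩

theorem IsCompact.continuous_legendre (hK : IsCompact K) (hne : K.Nonempty)
    (hG : ContinuousOn G K) : Continuous (legendre K G) := by
  obtain ⟨M, hM⟩ := hK.isBounded.exists_norm_le
  refine (LipschitzWith.of_le_add_mul M.toNNReal fun y y' => ?_).continuous
  obtain ⟨x, hx, hy⟩ := hK.exists_mem_subdifferential hne hG y
  have h1 := legendre_eq_of_mem_subdifferential hx hy
  have h2 := inner_le_add_legendre
    ((hK.subgradientImage_eq_univ hne hG).symm ▸ mem_univ y') hx
  have h3 := real_inner_le_norm x (y - y')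
  have h4 : ‖x‖ * ‖y - y'‖ ≤ M.toNNReal * ‖y - y'‖ := by
    gcongr
    exact (hM x hx).trans (Real.le_coe_toNNReal M)
  rw [inner_sub_right] at h3
  rw [dist_eq_norm]
  linarith

/-- A lower quadratic bound for a strongly convex function gives an upper quadratic bound, with
the inverse form, for its Legendre transform. -/
theorem StrongConvexOn.eventually_legendre_le (hK : IsCompact K) (hcont : ContinuousOn G K) {m : ℝ}
    (hG : StrongConvexOn K m G) (hm : 0 < m) {x y : 𝔼} (hx : x ∈ K)
    (hy : y ∈ subdifferential K G x) (e : OrthonormalBasis (Fin n) ℝ 𝔼) {d : Fin n → ℝ}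
    (hd : ∀ i, 0 < d i) (h : ∀ᶠ h in 𝓝 (0 : 𝔼), G x + ⟪y, h⟫ + diagForm e d h h / 2 ≤ G (x + h)) :
    ∀ᶠ k in 𝓝 (0 : 𝔼),
      legendre K G (y + k) ≤ legendre K G y + ⟪x, k⟫ + diagForm e d⁻¹ k k / 2 := by
  obtain ⟨δ, hδ, hball⟩ := Metric.eventually_nhds_iff_ball.mp h
  -- Strong convexity places the maximizer for slope y + k within ‖k‖/m < δ of `x`, where the
  -- quadratic bound applies.
  filter_upwards [ball_mem_nhds (0 : 𝔼) (show 0 < m * δ by positivity)] with k hk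
  obtain ⟨x', hx', hy'⟩ := hK.exists_mem_subdifferential ⟨x, hx⟩ hcont (y + k)
  obtain ⟨h, rfl⟩ : ∃ h, x' = x + h := ⟨x' - x, by abel⟩
  have h1 := hG.norm_sub_le hx' hx hy' hy
  rw [add_sub_cancel_left, add_sub_cancel_left] at h1
  rw [mem_ball_zero_iff] at hk
  have h2 := hball h (mem_ball_zero_iff.mpr (lt_of_mul_lt_mul_left (h1.trans_lt hk) hm.le))
  have h3 := inner_le_diagForm_add e hd k h
  rw [legendre_eq_of_mem_subdifferential hx hy, legendre_eq_of_mem_subdifferential hx' hy',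
    inner_add_left, inner_add_right, inner_add_right, real_inner_comm y h, real_inner_comm k h]
  linarith

end Compact

theorem le_of_eventually_le_form {a b : 𝔼 →L[ℝ] 𝔼 →L[ℝ] ℝ}
    (h : ∀ᶠ k in 𝓝 (0 : 𝔼), a k k ≤ b k k) (k : 𝔼) : a k k ≤ b k k := by
  have hc : Continuous fun t : ℝ => t • k := by fun_prop
  have hlim : Tendsto (fun t : ℝ => t • k) (𝓝[≠] 0) (𝓝 0) := by
    have := hc.tendsto 0
    rw [zero_smul] at this
    exact this.mono_left nhdsWithin_le_nhds
  obtain ⟨t, h1, h2⟩ := ((hlim.eventually h).and self_mem_nhdsWithin).exists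
  simp only [map_smul, smul_apply, smul_eq_mul] at h1
  have ht : t ≠ 0 := h2
  refine le_of_mul_le_mul_left ?_ (mul_self_pos.mpr ht)
  linarith

/-- If a quadratic form touches the Legendre transform of `F` strictly from below at `y₀`, it
touches the Legendre transforms of functions close to `F` at nearby points. -/
theorem StrongConvexOn.exists_touching_near {Ω : Set 𝔼} {F : 𝔼 → ℝ} {m : ℝ}
    (hF : StrongConvexOn Ω m F) (hm : 0 < m) (hΩ : IsOpen Ω) {x₀ y₀ : 𝔼} {r : ℝ} (hr : 0 < r)
    (hball : closedBall x₀ r ⊆ Ω) (hy₀ : y₀ ∈ subdifferential Ω F x₀)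
    {a : 𝔼 →L[ℝ] 𝔼 →L[ℝ] ℝ} (ha : ∀ h k, a h k = a k h) {κ : ℝ} (hκ : 0 < κ)
    (htouch : ∀ᶠ k in 𝓝 (0 : 𝔼),
      legendre Ω F y₀ + ⟪x₀, k⟫ + a k k / 2 + κ * ‖k‖ ^ 2 ≤ legendre Ω F (y₀ + k))
    {ρ : ℝ} (hρ : 0 < ρ) :
    ∃ σ > 0, ∀ G : 𝔼 → ℝ, ContinuousOn G (closedBall x₀ r) →
      (∀ x ∈ closedBall x₀ r, |G x - F x| ≤ σ) →
      ∃ x₁ ∈ ball x₀ ρ, ∃ y₁ ∈ ball y₀ ρ, x₁ ∈ closedBall x₀ r ∧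
        y₁ ∈ subdifferential (closedBall x₀ r) G x₁ ∧ ∃ l : 𝔼 →L[ℝ] ℝ, ∀ᶠ k in 𝓝 (0 : 𝔼),
          legendre (closedBall x₀ r) G y₁ + l k + a k k / 2 ≤
            legendre (closedBall x₀ r) G (y₁ + k) := by
  have hFc : ContinuousOn F Ω := (hF.convexOn fun t => by positivity).continuousOn hΩ
  have hx₀K : x₀ ∈ closedBall x₀ r := mem_closedBall_self hr.le
  have hx₀ : x₀ ∈ Ω := hball hx₀K
  have hy₀D : y₀ ∈ subgradientImage Ω F := mem_subgradientImage.mpr ⟨x₀, hx₀, hy₀⟩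
  obtain ⟨δ₀, hδ₀, htouch⟩ := Metric.eventually_nhds_iff_ball.mp htouch
  -- Within this radius the touching holds and the maximizer for F stays in `closedBall x₀ r`, so
  -- that F and G can be compared there.
  set δ := min δ₀ (m * r / 2) / 2
  have hδ : 0 < δ := by positivity
  have hδ₁ : δ < δ₀ := (half_lt_self (by positivity)).trans_le (min_le_left _ _)
  have hδ₂ : δ < m * r / 2 := (half_lt_self (by positivity)).trans_le (min_le_right _ _)
  set τ := min (min ρ δ) (m * ρ ^ 2 / (8 * r))
  have hτ : 0 < τ := by positivity
  have hτρ : τ ≤ ρ := (min_le_left _ _).trans (min_le_left _ _)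
  have hτδ : τ ≤ δ := (min_le_left _ _).trans (min_le_right _ _)
  have hτr : τ * r ≤ m * ρ ^ 2 / 8 := by
    have h1 : τ * r ≤ m * ρ ^ 2 / (8 * r) * r := by
      gcongr
      exact min_le_right _ _
    refine h1.trans_eq ?_
    field_simp
  set σ := min (κ * τ ^ 2 / 4) (m * ρ ^ 2 / 16)
  have hσ : 0 < σ := by positivity
  have hσ₁ : σ ≤ κ * τ ^ 2 / 4 := min_le_left _ _
  have hσ₂ : σ ≤ m * ρ ^ 2 / 16 := min_le_right _ _
  refine ⟨σ, hσ, fun G hG hGF => ?_⟩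
  have hK : IsCompact (closedBall x₀ r) := isCompact_closedBall x₀ r
  have hne : (closedBall x₀ r).Nonempty := ⟨x₀, hx₀K⟩
  have huniv := hK.subgradientImage_eq_univ hne hG
  set f := legendre (closedBall x₀ r) G
  have hfc : Continuous f := hK.continuous_legendre hne hG
  -- Sliding the quadratic until it touches: strictness gives κ‖k₁‖² ≤ 2σ < κτ², so the minimum is
  -- interior.
  obtain ⟨k₁, hk₁, hmin⟩ := (isCompact_closedBall (0 : 𝔼) δ).exists_isMinOn
    (f := fun k => f (y₀ + k) - ⟪x₀, k⟫ - a k k / 2) ⟨0, mem_closedBall_self hδ.le⟩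
    (by fun_prop)
  have hup : f y₀ ≤ legendre Ω F y₀ + σ := by
    obtain ⟨x, hx, hxy⟩ := hK.exists_mem_subdifferential hne hG y₀
    have h1 := legendre_eq_of_mem_subdifferential hx hxy
    have h2 := inner_le_add_legendre hy₀D (hball hx)
    have h3 := (abs_le.mp (hGF x hx)).1
    change f y₀ = _ at h1
    linarith
  have hlow : ∀ k ∈ closedBall (0 : 𝔼) δ,
      legendre Ω F y₀ + ⟪x₀, k⟫ + a k k / 2 + κ * ‖k‖ ^ 2 - σ ≤ f (y₀ + k) := by
    intro k hk
    rw [mem_closedBall_zero_iff] at hk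
    have h1 := htouch k (mem_ball_zero_iff.mpr (hk.trans_lt hδ₁))
    obtain ⟨x, hx, hxy⟩ := hF.exists_mem_subdifferential_of_norm_lt hm hFc hr hball hy₀
      (y := y₀ + k) (by rw [add_sub_cancel_left]; exact hk.trans_lt hδ₂)
    have h2 := legendre_eq_of_mem_subdifferential (hball hx) hxy
    have h3 := inner_le_add_legendre (huniv.symm ▸ mem_univ (y₀ + k)) hx
    have h4 := (abs_le.mp (hGF x hx)).2
    change _ ≤ _ + f (y₀ + k) at h3
    linarith
  have hk₁τ : ‖k₁‖ < τ := by
    have h1 : f (y₀ + k₁) - ⟪x₀, k₁⟫ - a k₁ k₁ / 2 ≤ f (y₀ + 0) - ⟪x₀, 0⟫ - a 0 0 / 2 :=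
      hmin (mem_closedBall_self hδ.le)
    simp only [add_zero, inner_zero_right, map_zero, sub_zero, zero_div] at h1
    have h2 := hlow k₁ hk₁
    have h3 : κ * ‖k₁‖ ^ 2 < κ * τ ^ 2 := by
      have : 0 < κ * τ ^ 2 := by positivity
      linarith
    exact lt_of_pow_lt_pow_left₀ 2 hτ.le (lt_of_mul_lt_mul_left h3 hκ.le)
  obtain ⟨x₁, hx₁, hxy₁⟩ := hK.exists_mem_subdifferential hne hG (y₀ + k₁)
  refine ⟨x₁, ?_, y₀ + k₁, ?_, hx₁, hxy₁, innerSL ℝ x₀ + a k₁, ?_⟩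
  -- Growth of F against near-minimality gives m‖x₁ - x₀‖²/2 ≤ τr + 2σ ≤ mρ²/4.
  · have h1 := hF.add_sq_le hx₀ hy₀ (hball hx₁)
    have h2 := hxy₁ x₀ hx₀K
    have h3 := (abs_le.mp (hGF x₁ hx₁)).1
    have h4 := (abs_le.mp (hGF x₀ hx₀K)).2
    have h5 := real_inner_le_norm k₁ (x₁ - x₀)
    have h6 : ‖x₁ - x₀‖ ≤ r := by rw [← dist_eq_norm]; exact mem_closedBall.mp hx₁
    have h7 : ‖k₁‖ * ‖x₁ - x₀‖ ≤ τ * r := by gcongr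
    rw [← neg_sub x₁ x₀, inner_neg_right, inner_add_left] at h2
    rw [mem_ball, dist_eq_norm]
    have h8 : m * ‖x₁ - x₀‖ ^ 2 < m * ρ ^ 2 := by
      have : 0 < m * ρ ^ 2 := by positivity
      linarith
    exact lt_of_pow_lt_pow_left₀ 2 hρ.le (lt_of_mul_lt_mul_left h8 hm.le)
  · rw [mem_ball, dist_eq_norm, add_sub_cancel_left]
    exact hk₁τ.trans_le hτρ
  · have hnear : ∀ᶠ k in 𝓝 (0 : 𝔼), k₁ + k ∈ closedBall (0 : 𝔼) δ := by
      refine (tendsto_add_nhds_zero k₁).eventually (mem_of_superset (isOpen_ball.mem_nhds ?_)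
        ball_subset_closedBall)
      rw [mem_ball_zero_iff]
      exact hk₁τ.trans_le hτδ
    filter_upwards [hnear] with k hk
    have h1 : f (y₀ + k₁) - ⟪x₀, k₁⟫ - a k₁ k₁ / 2 ≤
        f (y₀ + (k₁ + k)) - ⟪x₀, k₁ + k⟫ - a (k₁ + k) (k₁ + k) / 2 := hmin hk
    simp only [map_add, add_apply, inner_add_right, ha k k₁, ← add_assoc] at h1
    simp only [add_apply, innerSL_apply_apply]
    linarith

/-! ### The subsolution inequality through smooth approximation -/

theorem sin_pi_div_four_pos : 0 < Real.sin (Real.pi / 4) := by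
  rw [Real.sin_pi_div_four]; positivity

theorem cos_pi_div_four_pos : 0 < Real.cos (Real.pi / 4) := by
  rw [Real.cos_pi_div_four]; positivity

theorem cos_eq_sin_pi_div_four : Real.cos (Real.pi / 4) = Real.sin (Real.pi / 4) := by
  rw [Real.cos_pi_div_four, Real.sin_pi_div_four]

theorem ConvexOn.strongConvexOn_auxPotential {Ω : Set 𝔼} {u : 𝔼 → ℝ} (hu : ConvexOn ℝ Ω u) :
    StrongConvexOn Ω (Real.cos (Real.pi / 4)) (auxPotential u) :=
  hu.strongConvexOn_add_sq sin_pi_div_four_pos.le _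

theorem auxPotential_add (u : 𝔼 → ℝ) (x h : 𝔼) : auxPotential u (x + h) =
    Real.sin (Real.pi / 4) * u (x + h) + Real.cos (Real.pi / 4) / 2 *
      (‖x‖ ^ 2 + 2 * ⟪x, h⟫ + ‖h‖ ^ 2) := by
  rw [auxPotential, norm_add_sq_real]

theorem formPhase_diagForm_rotate (e : OrthonormalBasis (Fin n) ℝ 𝔼) {d : Fin n → ℝ}
    (hd : ∀ i, 0 < d i) :
    formPhase (diagForm e fun i => (Real.cos (Real.pi / 4) - (d i)⁻¹) / Real.sin (Real.pi / 4)) =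
      formPhase (diagForm e fun i => (d i - Real.cos (Real.pi / 4)) / Real.sin (Real.pi / 4)) -
        n * Real.pi / 4 := by
  rw [formPhase_diagForm, formPhase_diagForm]
  simp only [arctan_rotate (hd _), Finset.sum_sub_distrib, Finset.sum_const, Finset.card_univ,
    Fintype.card_fin, nsmul_eq_mul]
  ring

theorem diagForm_add_mul (e : OrthonormalBasis (Fin n) ℝ 𝔼) (d : Fin n → ℝ) (p q : ℝ) (h : 𝔼) :
    diagForm e (fun i => p * d i + q) h h = p * diagForm e d h h + q * ‖h‖ ^ 2 := by
  rw [← real_inner_self_eq_norm_sq, ← diagForm_const e, diagForm_apply, diagForm_apply,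
    diagForm_apply, Finset.mul_sum, ← Finset.sum_add_distrib]
  exact Finset.sum_congr rfl fun i _ => by ring

/-- At a touching point of a smooth convex function the gradient is determined by the slope. -/
theorem fderiv_eq_of_mem_subdifferential_auxPotential {K : Set 𝔼} {v : 𝔼 → ℝ} {x y : 𝔼}
    (hv : DifferentiableAt ℝ v x) (hK : K ∈ 𝓝 x) (hy : y ∈ subdifferential K (auxPotential v) x) :
    fderiv ℝ v x = innerSL ℝ ((Real.sin (Real.pi / 4))⁻¹ • (y - Real.cos (Real.pi / 4) • x)) := by
  have hs := sin_pi_div_four_pos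
  set c := Real.cos (Real.pi / 4)
  set s := Real.sin (Real.pi / 4)
  have hmin : IsLocalMin (fun z => auxPotential v z - ⟪y, z⟫) x := by
    filter_upwards [hK] with z hz
    exact mem_subdifferential_iff_isMinOn.mp hy hz
  have hd : HasFDerivAt (fun z => auxPotential v z - ⟪y, z⟫)
      (s • fderiv ℝ v x + (c / 2) • (2 • innerSL ℝ x) - innerSL ℝ y) x :=
    ((hv.hasFDerivAt.const_mul s).add
      ((hasStrictFDerivAt_norm_sq x).hasFDerivAt.const_mul (c / 2))).sub
      (innerSL ℝ y).hasFDerivAt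
  have h0 := hmin.hasFDerivAt_eq_zero hd
  ext w
  have h1 := congrArg (fun L : 𝔼 →L[ℝ] ℝ => L w) h0
  simp at h1
  simp only [innerSL_apply_apply, inner_smul_left, inner_sub_left, conj_trivial]
  rw [eq_inv_mul_iff_mul_eq₀ hs.ne']
  linarith

/-- The rotated phase inequality at a touching point of a smooth convex function. -/
theorem formPhase_sub_le_of_touching {K : Set 𝔼} {v : 𝔼 → ℝ} {x y : 𝔼}
    (hK : IsCompact K) (hx : K ∈ 𝓝 x) (hv : ContDiff ℝ 2 v) (hconv : ConvexOn ℝ K v)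
    (hy : y ∈ subdifferential K (auxPotential v) x)
    {a : 𝔼 →L[ℝ] 𝔼 →L[ℝ] ℝ} (ha : ∀ h k, a h k = a k h) {l : 𝔼 →L[ℝ] ℝ}
    (htouch : ∀ᶠ k in 𝓝 (0 : 𝔼), legendre K (auxPotential v) y + l k + a k k / 2 ≤
      legendre K (auxPotential v) (y + k)) :
    formPhase (fderiv ℝ (fderiv ℝ v) x) - n * Real.pi / 4 ≤
      formPhase ((Real.sin (Real.pi / 4))⁻¹ • (Real.cos (Real.pi / 4) • innerForm n - a)) := by
  have hs := sin_pi_div_four_pos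
  have hcpos := cos_pi_div_four_pos
  have hcs := cos_eq_sin_pi_div_four
  have hgrad := fderiv_eq_of_mem_subdifferential_auxPotential
    (hv.differentiable (by norm_num) x) hx hy
  have hrot := @formPhase_diagForm_rotate n
  have hxK : x ∈ K := mem_of_mem_nhds hx
  have hF := hconv.strongConvexOn_auxPotential
  have hadd := @auxPotential_add n v x
  have haux : auxPotential v x = Real.sin (Real.pi / 4) * v x + Real.cos (Real.pi / 4) / 2 *
    ‖x‖ ^ 2 := rfl
  set c := Real.cos (Real.pi / 4)
  set s := Real.sin (Real.pi / 4)
  have hvx : ContDiffAt ℝ 2 v x := hv.contDiffAt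
  have hsymm := hvx.fderiv_fderiv_symm
  have hpos := nonneg_of_second_order isOpen_interior (mem_interior_iff_mem_nhds.mpr hx)
    (hconv.subset interior_subset hconv.1.interior)
    fun ε hε => hvx.eventually_abs_taylor_two_le hε
  have taylor := fun ε (hε : 0 < ε) => hvx.eventually_abs_taylor_two_le hε
  obtain ⟨e, μ, hU⟩ := exists_eq_diagForm hsymm
  rw [hU] at hpos taylor ⊢
  have hμ : ∀ i, 0 ≤ μ i := fun i => diagForm_basis e μ i ▸ hpos (e i)
  have hA : ∀ h k, (s⁻¹ • (c • innerForm n - a)) h k = (s⁻¹ • (c • innerForm n - a)) k h :=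
    fun h k => by simp [ha h k, real_inner_comm h k]
  refine le_of_forall_pos_le_add fun ε hε => ?_
  -- The Hessian is lowered by η to get a genuine local lower bound. Since c = s and μ ≥ 0, η < 1
  -- keeps the form `d` of the auxiliary potential positive.
  set η := min (ε / (n + 1)) (1 / 2)
  have hη : 0 < η := by positivity
  have hη1 : η < 1 := (min_le_right _ _).trans_lt (by norm_num)
  have hηε : n * η ≤ ε := by
    have h1 : η ≤ ε / (n + 1) := min_le_left _ _
    rw [le_div_iff₀ (by positivity)] at h1
    linarith
  set d : Fin n → ℝ := fun i => s * μ i + (c - s * η)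
  have hd : ∀ i, 0 < d i := fun i => by
    have h1 := mul_nonneg hs.le (hμ i)
    have h2 : s * η < s * 1 := mul_lt_mul_of_pos_left hη1 hs
    simp only [d]
    linarith
  have hlow : ∀ᶠ h in 𝓝 (0 : 𝔼),
      auxPotential v x + ⟪y, h⟫ + diagForm e d h h / 2 ≤ auxPotential v (x + h) := by
    filter_upwards [taylor (η / 2) (by positivity)] with h hh
    have h1 := (abs_le.mp hh).1
    rw [hgrad, innerSL_apply_apply, inner_smul_left, inner_sub_left, inner_smul_left] at h1
    simp only [conj_trivial] at h1
    rw [hadd, haux, diagForm_add_mul]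
    have h2 := mul_le_mul_of_nonneg_left h1 hs.le
    have h3 : s * (s⁻¹ * (⟪y, h⟫ - c * ⟪x, h⟫)) = ⟪y, h⟫ - c * ⟪x, h⟫ := by field_simp
    rw [mul_sub, mul_sub, h3] at h2
    linarith
  have hcontv : ContinuousOn (auxPotential v) K := by
    have := hv.continuous
    unfold auxPotential
    fun_prop
  have hup := hF.eventually_legendre_le hK hcontv hcpos hxK hy e hd hlow
  have hneg : Tendsto (fun k : 𝔼 => -k) (𝓝 0) (𝓝 0) := by
    simpa using (continuous_neg (G := 𝔼)).tendsto 0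
  -- Adding the bounds at k and -k cancels the linear terms, so `l` need not be identified.
  have hle : ∀ k, a k k ≤ diagForm e d⁻¹ k k := by
    refine le_of_eventually_le_form ?_
    filter_upwards [hup, htouch, hneg.eventually hup, hneg.eventually htouch] with k h1 h2 h3 h4
    simp only [inner_neg_right, map_neg, neg_apply, neg_neg] at h3 h4
    linarith
  have hmono : formPhase (diagForm e fun i => (c - (d i)⁻¹) / s) ≤
      formPhase (s⁻¹ • (c • innerForm n - a)) := by
    refine formPhase_mono (diagForm_comm _ _) hA fun k => ?_
    have h1 : (fun i => (c - (d i)⁻¹) / s) = fun i => (-s⁻¹) * d⁻¹ i + s⁻¹ * c := by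
      funext i
      rw [Pi.inv_apply]
      ring
    rw [h1, diagForm_add_mul]
    simp only [smul_apply, sub_apply, innerForm_apply, smul_eq_mul, real_inner_self_eq_norm_sq]
    have := mul_le_mul_of_nonneg_left (hle k) (inv_nonneg.mpr hs.le)
    linarith
  rw [hrot e hd] at hmono
  have hle2 : formPhase (diagForm e μ) ≤ formPhase (diagForm e fun i => (d i - c) / s) + n * η := by
    refine formPhase_le_of_le_add (diagForm_comm _ _) (diagForm_comm _ _) hη.le fun k => ?_
    have h1 : (fun i => (d i - c) / s) = fun i => 1 * μ i + -η := by
      funext i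
      simp only [d]
      field_simp
      ring
    rw [h1, diagForm_add_mul]
    linarith
  linarith

/-- The rotated subsolution inequality for a quadratic form touching the Legendre transform
strictly from below. -/
theorem ConvexOn.le_formPhase_of_le_legendre {Ω : Set 𝔼} {u : 𝔼 → ℝ} (hΩ : IsOpen Ω)
    (hu : ConvexOn ℝ Ω u) {x₀ y₀ : 𝔼} (hx₀ : x₀ ∈ Ω)
    (hy₀ : y₀ ∈ subdifferential Ω (auxPotential u) x₀)
    {a : 𝔼 →L[ℝ] 𝔼 →L[ℝ] ℝ} (ha : ∀ h k, a h k = a k h) {κ : ℝ} (hκ : 0 < κ)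
    (htouch : ∀ᶠ k in 𝓝 (0 : 𝔼), legendre Ω (auxPotential u) y₀ + ⟪x₀, k⟫ + a k k / 2 +
      κ * ‖k‖ ^ 2 ≤ legendre Ω (auxPotential u) (y₀ + k)) {ξ : 𝔼} {L : ℝ}
    (hae : ∀ᶠ R in 𝓝[>] (0 : ℝ), ∀ᵐ y, y ∈ ball x₀ R →
      ∃ p ∈ subdifferential Ω u y, ∃ b : 𝔼 →L[ℝ] 𝔼 →L[ℝ] ℝ,
      (∀ h k, b h k = b k h) ∧ (∀ ε > 0, ∀ᶠ h in 𝓝 (0 : 𝔼),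
        |u (y + h) - u y - ⟪p, h⟫ - b h h / 2| ≤ ε * ‖h‖ ^ 2) ∧ L + ⟪ξ, p⟫ ≤ formPhase b) :
    L + ⟪ξ, (Real.sin (Real.pi / 4))⁻¹ • (y₀ - Real.cos (Real.pi / 4) • x₀)⟫ - n * Real.pi / 4 ≤
      formPhase ((Real.sin (Real.pi / 4))⁻¹ • (Real.cos (Real.pi / 4) • innerForm n - a)) := by
  have hs := sin_pi_div_four_pos
  have hs1 : Real.sin (Real.pi / 4) ≤ 1 := Real.sin_le_one _
  have hcpos := cos_pi_div_four_pos
  have hc1 : Real.cos (Real.pi / 4) ≤ 1 := Real.cos_le_one _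
  obtain ⟨R₁, hR₁, hball⟩ := nhds_basis_closedBall.mem_iff.mp (hΩ.mem_nhds hx₀)
  obtain ⟨R, hae, hR⟩ := (hae.and (Ioo_mem_nhdsGT hR₁)).exists
  set r := R / 3
  have hr : 0 < r := by have := hR.1; positivity
  have h3r : 3 * r = R := by simp only [r]; ring
  have hball3 : closedBall x₀ (3 * r) ⊆ Ω :=
    (closedBall_subset_closedBall (by rw [h3r]; exact hR.2.le)).trans hball
  have hballr : closedBall x₀ r ⊆ Ω :=
    (closedBall_subset_closedBall (by linarith)).trans hball3
  rw [← h3r] at hae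
  refine le_of_forall_pos_le_add fun ε hε => ?_
  -- The gradient s⁻¹(y - c x) moves by at most 2ρ/s, so its pairing with ξ changes by at most ε.
  set ρ := min r (ε * Real.sin (Real.pi / 4) / (2 * (‖ξ‖ + 1)))
  have hρ : 0 < ρ := by positivity
  obtain ⟨σ, hσ, hσG⟩ := hu.strongConvexOn_auxPotential.exists_touching_near hcpos hΩ hr hballr hy₀
    ha hκ htouch hρ
  obtain ⟨v, hv, hvconv, hvu, hvL⟩ := hu.exists_contDiff_approx hΩ hr hball3 hae hσ
  have hvcont := hv.continuous
  obtain ⟨x₁, hx₁, y₁, hy₁, hx₁K, hxy₁, l, hl⟩ := hσG (auxPotential v)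
    (by unfold auxPotential; fun_prop) fun x hx => by
      have h1 : auxPotential v x - auxPotential u x = Real.sin (Real.pi / 4) * (v x - u x) := by
        simp only [auxPotential]; ring
      rw [h1, abs_mul, abs_of_pos hs]
      exact (mul_le_of_le_one_left (abs_nonneg _) hs1).trans (hvu x hx)
  have hnhds : closedBall x₀ r ∈ 𝓝 x₁ := mem_of_superset (isOpen_ball.mem_nhds
    (ball_subset_ball (min_le_left _ _) hx₁)) ball_subset_closedBall
  have h1 := formPhase_sub_le_of_touching (isCompact_closedBall x₀ r) hnhds hv hvconv hxy₁ ha hl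
  have h2 := hvL x₁ hx₁K
  rw [fderiv_eq_of_mem_subdifferential_auxPotential (hv.differentiable (by norm_num) x₁) hnhds
    hxy₁, innerSL_apply_apply] at h2
  set c := Real.cos (Real.pi / 4)
  set s := Real.sin (Real.pi / 4)
  have h3 : ⟪ξ, s⁻¹ • (y₀ - c • x₀)⟫ - ⟪s⁻¹ • (y₁ - c • x₁), ξ⟫ ≤ ε := by
    have e1 : ⟪ξ, s⁻¹ • (y₀ - c • x₀)⟫ - ⟪s⁻¹ • (y₁ - c • x₁), ξ⟫ =
        s⁻¹ * ⟪ξ, c • (x₁ - x₀) - (y₁ - y₀)⟫ := by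
      rw [real_inner_comm, ← inner_sub_left, ← smul_sub, inner_smul_left, real_inner_comm]
      simp only [conj_trivial]
      congr 2
      module
    have e2 : ‖c • (x₁ - x₀) - (y₁ - y₀)‖ ≤ 2 * ρ := by
      rw [mem_ball, dist_eq_norm] at hx₁ hy₁
      refine (norm_sub_le _ _).trans ?_
      rw [norm_smul, Real.norm_of_nonneg hcpos.le]
      have := mul_le_of_le_one_left (norm_nonneg (x₁ - x₀)) hc1
      linarith
    have e3 : ‖ξ‖ * (2 * ρ) ≤ ε * s := by
      have h4 : ρ ≤ ε * s / (2 * (‖ξ‖ + 1)) := min_le_right _ _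
      rw [le_div_iff₀ (by positivity)] at h4
      nlinarith [norm_nonneg ξ]
    rw [e1, inv_mul_le_iff₀ hs]
    calc ⟪ξ, c • (x₁ - x₀) - (y₁ - y₀)⟫ ≤ ‖ξ‖ * ‖c • (x₁ - x₀) - (y₁ - y₀)‖ :=
          real_inner_le_norm _ _
      _ ≤ ‖ξ‖ * (2 * ρ) := by gcongr
      _ ≤ s * ε := by linarith
  linarith

/-! ### Affine lower bounds for the right-hand side -/

theorem gradient_eq_of_mem_subdifferential {Ω : Set 𝔼} {u : 𝔼 → ℝ} {x p : 𝔼} (hΩ : Ω ∈ 𝓝 x)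
    (hu : DifferentiableAt ℝ u x) (hp : p ∈ subdifferential Ω u x) : gradient u x = p := by
  have hmin : IsLocalMin (fun z => u z - ⟪p, z⟫) x := by
    filter_upwards [hΩ] with z hz
    exact mem_subdifferential_iff_isMinOn.mp hp hz
  have hd : HasFDerivAt (fun z => u z - ⟪p, z⟫) (fderiv ℝ u x - innerSL ℝ p) x :=
    hu.hasFDerivAt.sub (innerSL ℝ p).hasFDerivAt
  have h0 := sub_eq_zero.mp (hmin.hasFDerivAt_eq_zero hd)
  have h1 := hu.hasFDerivAt
  rw [h0] at h1
  exact HasGradientAt.gradient h1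

/-- Subgradients are locally bounded. -/
theorem ConvexOn.exists_eventually_norm_le {Ω : Set 𝔼} {u : 𝔼 → ℝ} (hΩ : IsOpen Ω)
    (hu : ConvexOn ℝ Ω u) {x₀ : 𝔼} (hx₀ : x₀ ∈ Ω) :
    ∃ M, ∀ᶠ x in 𝓝 x₀, ∀ p ∈ subdifferential Ω u x, ‖p‖ ≤ M := by
  obtain ⟨R, hR, hball⟩ := nhds_basis_closedBall.mem_iff.mp (hΩ.mem_nhds hx₀)
  obtain ⟨C, hC⟩ := (isCompact_closedBall x₀ R).exists_bound_of_continuousOn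
    ((hu.continuousOn hΩ).mono hball)
  refine ⟨2 * C / (R / 2), ?_⟩
  filter_upwards [closedBall_mem_nhds x₀ (half_pos hR)] with x hx p hp
  have hxR : x ∈ closedBall x₀ R := closedBall_subset_closedBall (by linarith) hx
  have hC0 : 0 ≤ C := (norm_nonneg _).trans (hC x hxR)
  rcases (norm_nonneg p).eq_or_lt with h0 | h0
  · rw [← h0]; positivity
  have hz : x + (R / 2 / ‖p‖) • p ∈ closedBall x₀ R := by
    rw [mem_closedBall, dist_eq_norm] at hx ⊢
    calc ‖x + (R / 2 / ‖p‖) • p - x₀‖ = ‖(x - x₀) + (R / 2 / ‖p‖) • p‖ := by congr 1; abel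
      _ ≤ ‖x - x₀‖ + ‖(R / 2 / ‖p‖) • p‖ := norm_add_le _ _
      _ ≤ R / 2 + R / 2 := by
          gcongr
          rw [norm_smul, Real.norm_of_nonneg (by positivity), div_mul_cancel₀ _ h0.ne']
      _ = R := by ring
  have h1 := hp _ (hball hz)
  rw [add_sub_cancel_left, inner_smul_right, real_inner_self_eq_norm_sq] at h1
  have h2 : R / 2 / ‖p‖ * ‖p‖ ^ 2 = ‖p‖ * (R / 2) := by field_simp
  have h3 := (abs_le.mp (hC x hxR)).1
  have h4 := (abs_le.mp (hC _ hz)).2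
  rw [le_div_iff₀ (by positivity)]
  linarith

/-- For a `C¹` solution, or a right-hand side convex in the gradient, the right-hand side has a
local lower bound that is affine in the gradient. -/
theorem exists_affine_le_rhs {Ω : Set 𝔼} {u : 𝔼 → ℝ} {ψ : 𝔼 → ℝ → 𝔼 → ℝ} (hΩ : IsOpen Ω)
    (hu : ConvexOn ℝ Ω u)
    (hψ : ContinuousOn (fun q : 𝔼 × ℝ × 𝔼 => ψ q.1 q.2.1 q.2.2) (Ω ×ˢ univ))
    (hcase : ContDiffOn ℝ 1 u Ω ∨ ∀ x ∈ Ω, ∀ r : ℝ, ConvexOn ℝ univ (ψ x r))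
    {x₀ p₀ : 𝔼} (hx₀ : x₀ ∈ Ω) (hp₀ : p₀ ∈ subdifferential Ω u x₀) {ε : ℝ} (hε : 0 < ε) :
    ∃ ξ : 𝔼, ∀ᶠ x in 𝓝 x₀, ∀ p ∈ subdifferential Ω u x,
      ψ x₀ (u x₀) p₀ - ε + ⟪ξ, p - p₀⟫ ≤ ψ x (u x) p := by
  have hucont : ContinuousAt u x₀ := (hu.continuousOn hΩ).continuousAt (hΩ.mem_nhds hx₀)
  have hψat : ∀ p, ContinuousAt (fun q : 𝔼 × ℝ × 𝔼 => ψ q.1 q.2.1 q.2.2) (x₀, u x₀, p) := fun p =>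
    hψ.continuousAt ((hΩ.prod isOpen_univ).mem_nhds ⟨hx₀, mem_univ _⟩)
  rcases hcase with hC1 | hconv
  -- For C¹ solutions p = Du(x) is continuous, so the right-hand side is nearly constant and slope
  -- zero suffices.
  · refine ⟨0, ?_⟩
    have hC1at : ∀ x ∈ Ω, ContDiffAt ℝ 1 u x := fun x hx => hC1.contDiffAt (hΩ.mem_nhds hx)
    have hgrad : ∀ x ∈ Ω, ∀ p ∈ subdifferential Ω u x, gradient u x = p := fun x hx p hp =>
      gradient_eq_of_mem_subdifferential (hΩ.mem_nhds hx)
        ((hC1at x hx).differentiableAt (by simp)) hp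
    have hgc : ContinuousAt (gradient u) x₀ := by
      have h1 : ContinuousAt (fderiv ℝ u) x₀ := ((hC1at x₀ hx₀).fderiv_right
        (m := 0) (by norm_num)).continuousAt
      exact (InnerProductSpace.toDual ℝ 𝔼).symm.continuous.continuousAt.comp h1
    have hlim : Tendsto (fun x => ψ x (u x) (gradient u x)) (𝓝 x₀) (𝓝 (ψ x₀ (u x₀) p₀)) := by
      have h1 : Tendsto (fun x => (x, u x, gradient u x)) (𝓝 x₀) (𝓝 (x₀, u x₀, p₀)) := by
        refine tendsto_id.prodMk_nhds (Tendsto.prodMk_nhds hucont ?_)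
        rw [← hgrad x₀ hx₀ p₀ hp₀]
        exact hgc
      exact (hψat p₀).tendsto.comp h1
    filter_upwards [hlim.eventually (lt_mem_nhds (sub_lt_self _ hε)), hΩ.mem_nhds hx₀]
      with x hx hxΩ p hp
    rw [← hgrad x hxΩ p hp, inner_zero_left, add_zero]
    exact hx.le
  · obtain ⟨ξ, hξ⟩ := (hconv x₀ hx₀ (u x₀)).exists_mem_subdifferential isOpen_univ (mem_univ p₀)
    obtain ⟨M, hM⟩ := hu.exists_eventually_norm_le hΩ hx₀
    refine ⟨ξ, ?_⟩
    -- Subgradients need not be close to p₀, only bounded; compactness makes the comparison of ψ at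
    -- x and x₀ uniform in p, and convexity at x₀ supplies the affine minorant.
    have htube : ∀ᶠ x in 𝓝 x₀, ∀ p ∈ closedBall (0 : 𝔼) M,
        ψ x₀ (u x₀) p - ε < ψ x (u x) p := by
      refine (isCompact_closedBall (0 : 𝔼) M).eventually_forall_of_forall_eventually fun p _ => ?_
      have h1 : Tendsto (fun z : 𝔼 × 𝔼 => (z.1, u z.1, z.2)) (𝓝 (x₀, p)) (𝓝 (x₀, u x₀, p)) :=
        continuousAt_fst.tendsto.prodMk_nhds
          ((Tendsto.comp hucont continuousAt_fst.tendsto).prodMk_nhds continuousAt_snd.tendsto)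
      have h2 : Tendsto (fun z : 𝔼 × 𝔼 => (x₀, u x₀, z.2)) (𝓝 (x₀, p)) (𝓝 (x₀, u x₀, p)) :=
        tendsto_const_nhds.prodMk_nhds (tendsto_const_nhds.prodMk_nhds continuousAt_snd.tendsto)
      have h3 := ((hψat p).tendsto.comp h1).sub ((hψat p).tendsto.comp h2)
      rw [sub_self] at h3
      filter_upwards [h3.eventually (lt_mem_nhds (neg_lt_zero.mpr hε))] with z hz
      simp only [Function.comp_apply] at hz
      linarith
    filter_upwards [hM, htube] with x hxM hx p hp
    have h1 := hx p (mem_closedBall_zero_iff.mpr (hxM p hp))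
    have h2 := hξ p (mem_univ p)
    linarith

/-! ### The rotated potential and its two viscosity inequalities -/

section Rotation

variable {Ω : Set (EuclideanSpace ℝ (Fin n))} {u : EuclideanSpace ℝ (Fin n) → ℝ}

theorem mem_rotatedDomain {y : 𝔼} :
    y ∈ rotatedDomain Ω u ↔ ∃ x ∈ Ω, y ∈ subdifferential Ω (auxPotential u) x :=
  mem_subgradientImage

theorem ConvexOn.isOpen_rotatedDomain (hu : ConvexOn ℝ Ω u) (hΩ : IsOpen Ω) :
    IsOpen (rotatedDomain Ω u) :=
  hu.strongConvexOn_auxPotential.isOpen_subgradientImage cos_pi_div_four_pos hΩ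

theorem ConvexOn.hasGradientAt_rotatedPotential (hu : ConvexOn ℝ Ω u) (hΩ : IsOpen Ω) {x y : 𝔼}
    (hx : x ∈ Ω) (hy : y ∈ subdifferential Ω (auxPotential u) x) :
    HasGradientAt (rotatedPotential Ω u)
      ((Real.sin (Real.pi / 4))⁻¹ • (Real.cos (Real.pi / 4) • y - x)) y := by
  have hs := sin_pi_div_four_pos
  have h1 := (hu.strongConvexOn_auxPotential.hasGradientAt_legendre cos_pi_div_four_pos hΩ hx
    hy).hasFDerivAt
  have h2 := ((hasStrictFDerivAt_norm_sq y).hasFDerivAt.const_mul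
    (Real.cos (Real.pi / 4) / (2 * Real.sin (Real.pi / 4)))).sub
    (h1.const_mul (1 / Real.sin (Real.pi / 4)))
  refine HasFDerivAt.congr_fderiv h2 ?_
  ext w
  simp [-Real.cos_pi_div_four, -Real.sin_pi_div_four]
  field_simp

theorem basePoint_smul (x y : 𝔼) :
    basePoint y ((Real.sin (Real.pi / 4))⁻¹ • (Real.cos (Real.pi / 4) • y - x)) = x := by
  rw [basePoint, smul_inv_smul₀ sin_pi_div_four_pos.ne', sub_sub_cancel]

theorem sin_smul_add_cos_smul (x y : 𝔼) : Real.sin (Real.pi / 4) • y +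
    Real.cos (Real.pi / 4) • (Real.sin (Real.pi / 4))⁻¹ • (Real.cos (Real.pi / 4) • y - x) =
      (Real.sin (Real.pi / 4))⁻¹ • (y - Real.cos (Real.pi / 4) • x) := by
  have hs := sin_pi_div_four_pos.ne'
  have h := Real.sin_sq_add_cos_sq (Real.pi / 4)
  have h1 : Real.sin (Real.pi / 4) + Real.cos (Real.pi / 4) * ((Real.sin (Real.pi / 4))⁻¹ *
      Real.cos (Real.pi / 4)) = (Real.sin (Real.pi / 4))⁻¹ := by
    field_simp
    linarith
  rw [smul_sub, smul_sub, smul_sub, smul_smul, smul_smul, smul_smul, smul_smul, add_sub, ← add_smul,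
    mul_assoc, h1, mul_comm (Real.cos _) (Real.sin _)⁻¹]

theorem rotatedPhase_smul (ψ : 𝔼 → ℝ → 𝔼 → ℝ) (x y : 𝔼) (r : ℝ) :
    rotatedPhase ψ u y r ((Real.sin (Real.pi / 4))⁻¹ • (Real.cos (Real.pi / 4) • y - x)) =
      ψ x (u x) ((Real.sin (Real.pi / 4))⁻¹ • (y - Real.cos (Real.pi / 4) • x)) -
        n * Real.pi / 4 := by
  rw [rotatedPhase, basePoint_smul, sin_smul_add_cos_smul]

theorem legendre_eq_sub_rotatedPotential (y : 𝔼) : legendre Ω (auxPotential u) y =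
    Real.cos (Real.pi / 4) / 2 * ‖y‖ ^ 2 - Real.sin (Real.pi / 4) * rotatedPotential Ω u y := by
  have hs := sin_pi_div_four_pos.ne'
  rw [rotatedPotential]
  field_simp
  ring

/-- The Legendre transform near `y`, with the linear part isolated, in terms of the rotated
potential. -/
theorem legendre_add_eq (x y k : 𝔼) : legendre Ω (auxPotential u) (y + k) =
    legendre Ω (auxPotential u) y + ⟪x, k⟫ + Real.cos (Real.pi / 4) / 2 * ‖k‖ ^ 2 -
      Real.sin (Real.pi / 4) * (rotatedPotential Ω u (y + k) - rotatedPotential Ω u y -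
        ⟪(Real.sin (Real.pi / 4))⁻¹ • (Real.cos (Real.pi / 4) • y - x), k⟫) := by
  have hs := sin_pi_div_four_pos.ne'
  rw [legendre_eq_sub_rotatedPotential, legendre_eq_sub_rotatedPotential, norm_add_sq_real,
    inner_smul_left, inner_sub_left, inner_smul_left]
  simp only [conj_trivial]
  field_simp
  ring

variable {ψ : EuclideanSpace ℝ (Fin n) → ℝ → EuclideanSpace ℝ (Fin n) → ℝ}

theorem hasGradientAt_of_isLocalExtr {w φ : 𝔼 → ℝ} {y g : 𝔼} (hw : HasGradientAt w g y)
    (hφ : DifferentiableAt ℝ φ y) (h : IsLocalExtr (fun z => w z - φ z) y) :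
    HasGradientAt φ g y := by
  have h0 := h.hasFDerivAt_eq_zero (hw.hasFDerivAt.sub hφ.hasFDerivAt)
  have h1 := hφ.hasFDerivAt
  rw [← sub_eq_zero.mp h0] at h1
  exact h1

/-- The direct half: an upper quadratic bound on F* dualizes to a quadratic test function below u.
-/
theorem IsViscositySolution.phase_hessian_le_rotatedPhase (hΩ : IsOpen Ω) (hu : ConvexOn ℝ Ω u)
    (hvisc : IsViscositySolution Ω ψ u) {y : 𝔼} (hy : y ∈ rotatedDomain Ω u) {φ : 𝔼 → ℝ}
    (hφ : ContDiffAt ℝ 2 φ y)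
    (hmin : IsLocalMinOn (fun z => rotatedPotential Ω u z - φ z) (rotatedDomain Ω u) y) :
    phase (hessian φ y) ≤ rotatedPhase ψ u y (rotatedPotential Ω u y) (gradient φ y) := by
  have hs := sin_pi_div_four_pos
  have hD := hu.isOpen_rotatedDomain hΩ
  obtain ⟨x, hx, hxy⟩ := mem_rotatedDomain.mp hy
  have hmin' : IsLocalMin (fun z => rotatedPotential Ω u z - φ z) y :=
    hmin.isLocalMin (hD.mem_nhds hy)
  have hgrad := hasGradientAt_of_isLocalExtr (hu.hasGradientAt_rotatedPotential hΩ hx hxy)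
    (hφ.differentiableAt (by simp)) (Or.inl hmin')
  rw [hgrad.gradient, rotatedPhase_smul]
  have hleg := @legendre_add_eq n Ω u x y
  have hfd : ∀ k, fderiv ℝ φ y k =
      ⟪(Real.sin (Real.pi / 4))⁻¹ • (Real.cos (Real.pi / 4) • y - x), k⟫ := fun k => by
    rw [hgrad.hasFDerivAt.fderiv]; rfl
  have hrot := @formPhase_diagForm_rotate n
  have hadd := @auxPotential_add n u x
  have haux : auxPotential u x = Real.sin (Real.pi / 4) * u x + Real.cos (Real.pi / 4) / 2 *
    ‖x‖ ^ 2 := rfl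
  change formPhase (fderiv ℝ (fderiv ℝ φ) y) ≤ _
  set c := Real.cos (Real.pi / 4)
  set s := Real.sin (Real.pi / 4)
  have hbsymm := hφ.fderiv_fderiv_symm
  have taylor := fun ε (hε : 0 < ε) => hφ.eventually_abs_taylor_two_le hε
  set b := fderiv ℝ (fderiv ℝ φ) y
  refine le_of_forall_pos_le_add fun ε' hε' => ?_
  set ε := ε' / (n + 1)
  have hε : 0 < ε := by positivity
  have hεn : n * ε ≤ ε' := by
    have : (n + 1) * ε = ε' := by simp only [ε]; field_simp
    linarith
  -- The Hessian of c|·|²/2 - sφ, raised by sε: half of the raise absorbs the Taylor error, the rest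
  -- makes the form strictly positive, since F* lies above its tangent.
  set a : 𝔼 →L[ℝ] 𝔼 →L[ℝ] ℝ := c • innerForm n - s • b + (s * ε) • innerForm n
  have ha : ∀ h k, a h k = a k h := fun h k => by
    simp [a, hbsymm h k, real_inner_comm h k]
  have haa : ∀ k, a k k = (c + s * ε) * ‖k‖ ^ 2 - s * b k k := fun k => by
    simp [a]
    ring
  have hup : ∀ᶠ k in 𝓝 (0 : 𝔼), legendre Ω (auxPotential u) (y + k) ≤
      legendre Ω (auxPotential u) y + ⟪x, k⟫ + a k k / 2 - s * ε / 4 * ‖k‖ ^ 2 := by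
    filter_upwards [taylor (ε / 4) (by positivity),
      (tendsto_add_nhds_zero y).eventually hmin'] with k h1 h2
    have h3 := (abs_le.mp h1).1
    rw [hfd] at h3
    rw [hleg k, haa]
    have h4 := mul_le_mul_of_nonneg_left (show ⟪s⁻¹ • (c • y - x), k⟫ + b k k / 2 -
      ε / 4 * ‖k‖ ^ 2 ≤ rotatedPotential Ω u (y + k) - rotatedPotential Ω u y by linarith) hs.le
    linarith
  have hapos : ∀ k, ((s * ε / 2) • innerForm n) k k ≤ a k k := by
    refine le_of_eventually_le_form ?_
    filter_upwards [hup, (tendsto_add_nhds_zero y).eventually (hD.mem_nhds hy)] with k h1 h2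
    have h3 := inner_le_add_legendre h2 hx
    have h4 := legendre_eq_of_mem_subdifferential hx hxy
    rw [inner_add_right] at h3
    simp only [smul_apply, innerForm_apply, smul_eq_mul, real_inner_self_eq_norm_sq]
    linarith
  obtain ⟨e, d, hed⟩ := exists_eq_diagForm ha
  have hd : ∀ i, 0 < d i := fun i => by
    have h1 := hapos (e i)
    rw [hed, diagForm_basis] at h1
    simp only [smul_apply, innerForm_apply, smul_eq_mul, real_inner_self_eq_norm_sq,
      e.norm_eq_one] at h1
    have : 0 < s * ε := by positivity
    linarith
  rw [hed] at hup
  have hlow := eventually_le_of_legendre_le hΩ hD hx hxy e hd le_rfl (hup.mono fun k hk => by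
    have : 0 ≤ s * ε / 4 * ‖k‖ ^ 2 := by positivity
    linarith)
  have hinv : (fun i => (d⁻¹ i - c) / s) = fun i => s⁻¹ * d⁻¹ i + -(s⁻¹ * c) := by
    funext i
    ring
  have htest := hvisc.formPhase_le (p := s⁻¹ • (y - c • x)) hx
    (B := diagForm e fun i => (d⁻¹ i - c) / s) (diagForm_comm _ _) (by
      filter_upwards [hlow] with h hh
      rw [hadd, haux] at hh
      rw [hinv, diagForm_add_mul, inner_smul_left, inner_sub_left, inner_smul_left]
      simp only [conj_trivial]
      refine le_of_mul_le_mul_left ?_ hs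
      have h1 : s * (u x + s⁻¹ * (⟪y, h⟫ - c * ⟪x, h⟫) +
          (s⁻¹ * diagForm e d⁻¹ h h + -(s⁻¹ * c) * ‖h‖ ^ 2) / 2) =
          s * u x + (⟪y, h⟫ - c * ⟪x, h⟫) + (diagForm e d⁻¹ h h - c * ‖h‖ ^ 2) / 2 := by
        field_simp
        ring
      rw [h1]
      linarith)
  have hrot' := hrot e (d := d⁻¹) fun i => inv_pos.mpr (hd i)
  simp only [Pi.inv_apply, inv_inv] at hrot' htest
  have hle := formPhase_le_of_le_add hbsymm (diagForm_comm e fun i => (c - d i) / s) hε.le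
    fun k => by
      have h1 : (fun i => (c - d i) / s) = fun i => (-s⁻¹) * d i + s⁻¹ * c := by
        funext i
        ring
      rw [h1, diagForm_add_mul, ← hed, haa]
      refine le_of_eq ?_
      field_simp
      ring
  linarith

/-- The indirect half: F* is touched from below by a form of unknown sign, so the inequality passes
through `ConvexOn.le_formPhase_of_le_legendre`. -/
theorem IsViscositySolution.rotatedPhase_le_phase_hessian (hΩ : IsOpen Ω) (hu : ConvexOn ℝ Ω u)
    (hψ : ContinuousOn (fun q : 𝔼 × ℝ × 𝔼 => ψ q.1 q.2.1 q.2.2) (Ω ×ˢ univ))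
    (hvisc : IsViscositySolution Ω ψ u)
    (hcase : ContDiffOn ℝ 1 u Ω ∨ ∀ x ∈ Ω, ∀ r : ℝ, ConvexOn ℝ univ (ψ x r))
    {y : 𝔼} (hy : y ∈ rotatedDomain Ω u) {φ : 𝔼 → ℝ} (hφ : ContDiffAt ℝ 2 φ y)
    (hmax : IsLocalMaxOn (fun z => rotatedPotential Ω u z - φ z) (rotatedDomain Ω u) y) :
    rotatedPhase ψ u y (rotatedPotential Ω u y) (gradient φ y) ≤ phase (hessian φ y) := by
  have hs := sin_pi_div_four_pos
  have hD := hu.isOpen_rotatedDomain hΩ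
  obtain ⟨x, hx, hxy⟩ := mem_rotatedDomain.mp hy
  have hmax' : IsLocalMax (fun z => rotatedPotential Ω u z - φ z) y :=
    hmax.isLocalMax (hD.mem_nhds hy)
  have hgrad := hasGradientAt_of_isLocalExtr (hu.hasGradientAt_rotatedPotential hΩ hx hxy)
    (hφ.differentiableAt (by simp)) (Or.inr hmax')
  rw [hgrad.gradient, rotatedPhase_smul]
  have hleg := @legendre_add_eq n Ω u x y
  have hfd : ∀ k, fderiv ℝ φ y k =
      ⟪(Real.sin (Real.pi / 4))⁻¹ • (Real.cos (Real.pi / 4) • y - x), k⟫ := fun k => by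
    rw [hgrad.hasFDerivAt.fderiv]; rfl
  have hp₀ : (Real.sin (Real.pi / 4))⁻¹ • (y - Real.cos (Real.pi / 4) • x) ∈
      subdifferential Ω u x := mem_subdifferential_of_add_sq hu hs hx hxy
  have hsub := @ConvexOn.le_formPhase_of_le_legendre n Ω u hΩ hu x y hx hxy
  change _ ≤ formPhase (fderiv ℝ (fderiv ℝ φ) y)
  set c := Real.cos (Real.pi / 4)
  set s := Real.sin (Real.pi / 4)
  set p₀ := s⁻¹ • (y - c • x)
  have hbsymm := hφ.fderiv_fderiv_symm
  have taylor := fun ε (hε : 0 < ε) => hφ.eventually_abs_taylor_two_le hε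
  set b := fderiv ℝ (fderiv ℝ φ) y
  refine le_of_forall_pos_le_add fun ε' hε' => ?_
  set ε := ε' / (n + 1)
  have hε : 0 < ε := by positivity
  have hεn : n * ε + ε = ε' := by simp only [ε]; field_simp
  -- Lowering by sε leaves the margin sε‖k‖²/4 that makes the touching strict. It costs nε in the
  -- phase, and the affine minorant costs one more ε.
  set a : 𝔼 →L[ℝ] 𝔼 →L[ℝ] ℝ := c • innerForm n - s • b - (s * ε) • innerForm n
  have ha : ∀ h k, a h k = a k h := fun h k => by
    simp [a, hbsymm h k, real_inner_comm h k]
  have haa : ∀ k, a k k = (c - s * ε) * ‖k‖ ^ 2 - s * b k k := fun k => by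
    simp [a]
    ring
  have hlow : ∀ᶠ k in 𝓝 (0 : 𝔼), legendre Ω (auxPotential u) y + ⟪x, k⟫ + a k k / 2 +
      s * ε / 4 * ‖k‖ ^ 2 ≤ legendre Ω (auxPotential u) (y + k) := by
    filter_upwards [taylor (ε / 4) (by positivity),
      (tendsto_add_nhds_zero y).eventually hmax'] with k h1 h2
    have h3 := (abs_le.mp h1).2
    rw [hfd] at h3
    rw [hleg k, haa]
    have h4 := mul_le_mul_of_nonneg_left (show rotatedPotential Ω u (y + k) -
      rotatedPotential Ω u y ≤ ⟪s⁻¹ • (c • y - x), k⟫ + b k k / 2 + ε / 4 * ‖k‖ ^ 2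
      by linarith) hs.le
    linarith
  obtain ⟨ξ, hξ⟩ := exists_affine_le_rhs hΩ hu hψ hcase hx hp₀ hε
  obtain ⟨δ, hδ, hball⟩ := Metric.eventually_nhds_iff_ball.mp (hξ.and (hΩ.mem_nhds hx))
  have hmain := hsub ha (show 0 < s * ε / 4 by positivity) hlow (ξ := ξ)
    (L := ψ x (u x) p₀ - ε - ⟪ξ, p₀⟫) (by
      filter_upwards [Ioo_mem_nhdsGT hδ] with R hR
      filter_upwards [hu.ae_exists_second_order hΩ] with z hz hzR
      obtain ⟨hz1, hzΩ⟩ := hball z (ball_subset_ball hR.2.le hzR)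
      obtain ⟨p, hp, b, hb, hexp⟩ := hz hzΩ
      refine ⟨p, hp, b, hb, hexp, ?_⟩
      have h1 := hz1 p hp
      have h2 := hvisc.le_formPhase_of_second_order hzΩ hb hexp
      rw [inner_sub_right] at h1
      linarith)
  have hle := formPhase_le_of_le_add (b := s⁻¹ • (c • innerForm n - a))
    (fun h k => by simp [ha h k, real_inner_comm h k]) hbsymm hε.le fun k => by
      simp only [smul_apply, sub_apply, innerForm_apply, smul_eq_mul, real_inner_self_eq_norm_sq,
        haa]
      refine le_of_eq ?_
      field_simp
      ring
  linarith

end Rotation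

end

theorem proposition2p2 (n : ℕ)
    (ψ : EuclideanSpace ℝ (Fin n) → ℝ → EuclideanSpace ℝ (Fin n) → ℝ)
    (hψ : ContinuousOn
      (fun q : EuclideanSpace ℝ (Fin n) × ℝ × EuclideanSpace ℝ (Fin n) => ψ q.1 q.2.1 q.2.2)
      (ball (0 : EuclideanSpace ℝ (Fin n)) 1 ×ˢ univ))
    (u : EuclideanSpace ℝ (Fin n) → ℝ)
    (hconv : ConvexOn ℝ (ball (0 : EuclideanSpace ℝ (Fin n)) 1) u)
    (hu : IsViscositySolution (ball (0 : EuclideanSpace ℝ (Fin n)) 1) ψ u)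
    (hcase : ContDiffOn ℝ 1 u (ball (0 : EuclideanSpace ℝ (Fin n)) 1) ∨
      ∀ x ∈ ball (0 : EuclideanSpace ℝ (Fin n)) 1, ∀ r : ℝ, ConvexOn ℝ univ (ψ x r)) :
    -- the rotated domain is open, and `ū`, `x(x̄) = c x̄ - s Dū(x̄)` are well defined on it
    IsOpen (rotatedDomain (ball (0 : EuclideanSpace ℝ (Fin n)) 1) u) ∧
    (∀ y ∈ rotatedDomain (ball (0 : EuclideanSpace ℝ (Fin n)) 1) u,
      DifferentiableAt ℝ (rotatedPotential (ball (0 : EuclideanSpace ℝ (Fin n)) 1) u) y ∧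
      basePoint y (gradient (rotatedPotential (ball (0 : EuclideanSpace ℝ (Fin n)) 1) u) y)
        ∈ ball (0 : EuclideanSpace ℝ (Fin n)) 1) ∧
    -- `ū` is a viscosity solution of the rotated equation there
    IsViscositySolution (rotatedDomain (ball (0 : EuclideanSpace ℝ (Fin n)) 1) u)
      (rotatedPhase ψ u)
      (rotatedPotential (ball (0 : EuclideanSpace ℝ (Fin n)) 1) u) := by
  have hD := hconv.isOpen_rotatedDomain isOpen_ball
  have hdiff : ∀ y ∈ rotatedDomain (ball (0 : EuclideanSpace ℝ (Fin n)) 1) u,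
      DifferentiableAt ℝ (rotatedPotential (ball (0 : EuclideanSpace ℝ (Fin n)) 1) u) y ∧
      basePoint y (gradient (rotatedPotential (ball (0 : EuclideanSpace ℝ (Fin n)) 1) u) y)
        ∈ ball (0 : EuclideanSpace ℝ (Fin n)) 1 := by
    intro y hy
    obtain ⟨x, hx, hxy⟩ := mem_rotatedDomain.mp hy
    have hgrad := hconv.hasGradientAt_rotatedPotential isOpen_ball hx hxy
    refine ⟨hgrad.differentiableAt, ?_⟩
    rwa [hgrad.gradient, basePoint_smul]
  exact ⟨hD, hdiff, fun y hy => (hdiff y hy).1.continuousAt.continuousWithinAt,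
    fun y hy φ hφ hmax =>
      hu.rotatedPhase_le_phase_hessian isOpen_ball hconv hψ hcase hy hφ hmax,
    fun y hy φ hφ hmin => hu.phase_hessian_le_rotatedPhase isOpen_ball hconv hy hφ hmin⟩
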